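/- Theorem (fractional powers of the discrete Laplacian on Hölder classes). Let $N\ge 1$ and, for $\mathbf n\in\mathbb Z^N$, write $|\mathbf n|=|n_1|+\dots+|n_N|$. Let $\Delta_N f(\mathbf n)=\sum_{i=1}^N\bigl(f(\mathbf n+\mathbf e_i)-2f(\mathbf n)+f(\mathbf n-\mathbf e_i)\bigr)$ be the discrete Laplacian and $W_t=e^{t\Delta_N}$ its heat semigroup, given for $t>0$ by $$W_tf(\mathbf n)=\sum_{\mathbf k\in\mathbb Z^N}G_{t,N}(\mathbf n-\mathbf k)f(\mathbf k),\qquad G_{t,N}(\mathbf n)=\prod_{i=1}^N e^{-2t}I_{n_i}(2t),$$ where $I_a$ is the modified Bessel function of the first kind. For $0<s<1$ define the fractional power $$(-\Delta_N)^sf(\mathbf n)=\frac1{\Gamma(-s)}\int_0^\infty\bigl(W_tf(\mathbf n)-f(\mathbf n)\bigr)\frac{dt}{t^{s+1}},$$ and let $\ell_{-s}(\mathbb Z^N)$ be the space of (real or complex) sequences $f$ on $\mathbb Z^N$ with $\sum_{\mathbf n}|f(\mathbf n)|(1+|\mathbf n|)^{-2s-N}<\infty$. For $0<\alpha\le1$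 put $[f]_{C^{0,\alpha}}=\sup_{\mathbf n\ne\mathbf m}|f(\mathbf n)-f(\mathbf m)|/|\mathbf n-\mathbf m|^\alpha$ and, with $\delta_i^+f(\mathbf n)=f(\mathbf n+\mathbf e_i)-f(\mathbf n)$ and $k\ge0$, $$[f]_{C^{k,\alpha}}=\sum_{m_1+\dots+m_N=k}\bigl[(\delta_1^+)^{m_1}\cdots(\delta_N^+)^{m_N}f\bigr]_{C^{0,\alpha}};$$ $C^{k,\alpha}(\mathbb Z^N)$ is the class of sequences $f$ with $[f]_{C^{k,\alpha}}<\infty$. Let $N\ge1$, $k\ge0$, $0<\alpha\le1$ and $0<s<1$. For every $f\in\ell_{-s}(\mathbb Z^N)$ the series and the integral defining $(-\Delta_N)^sf(\mathbf n)$ converge absolutely for every $\mathbf n$. Moreover: (i) If $2s<\alpha$, there is a constant $C$, depending only on $N,k,\alpha,s$, such that for every $f\in\ell_{-s}(\mathbb Z^N)\cap C^{k,\alpha}(\mathbb Z^N)$ one has $(-\Delta_N)^sf\in C^{k,\alpha-2s}(\mathbb Z^N)$ and $$[(-\Delta_N)^sf]_{C^{k,\alpha-2s}}\le C\,[f]_{C^{k,\alpha}}.$$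 (ii) If $\alpha<2s<\alpha+1$, there is a constant $C$, depending only on $N,k,\alpha,s$, such that for every $f\in\ell_{-s}(\mathbb Z^N)\cap C^{k+1,\alpha}(\mathbb Z^N)$ one has $(-\Delta_N)^sf\in C^{k,\alpha-2s+1}(\mathbb Z^N)$ and $$[(-\Delta_N)^sf]_{C^{k,\alpha-2s+1}}\le C\,[f]_{C^{k+1,\alpha}}.$$ -/

import Mathlib

open scoped NNReal ENNReal

noncomputable section

namespace DiscreteLaplacian

/-- The modified Bessel function of the first kind of integer order `n`,
`I_n(x) = ∑_{j ≥ 0} (x/2)^(2j+n) / (j! Γ(n+j+1))`. The terms with `n + j + 1 ≤ 0` vanish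
(`1/Γ = 0` at the poles of `Γ`), which agrees with `Real.Gamma` being `0` there. -/
def besselI (n : ℤ) (x : ℝ) : ℝ :=
  ∑' j : ℕ, (Real.Gamma ((n : ℝ) + (j : ℝ) + 1))⁻¹ / (j.factorial : ℝ) *
    (x / 2) ^ (2 * (j : ℤ) + n)

/-- The length `|n| = |n_1| + ⋯ + |n_N|` of a lattice point. -/
def len {N : ℕ} (n : Fin N → ℤ) : ℝ :=
  ∑ i, |(n i : ℝ)|

/-- The heat kernel of the discrete Laplacian on `ℤ^N`:
`G_{t,N}(n) = ∏_i e^{-2t} I_{n_i}(2t)`. -/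
def heatKernel {N : ℕ} (t : ℝ) (n : Fin N → ℤ) : ℝ :=
  ∏ i, Real.exp (-2 * t) * besselI (n i) (2 * t)

/-- The heat semigroup `W_t f(n) = ∑_{k ∈ ℤ^N} G_{t,N}(n - k) f(k)`. -/
def heat {𝕜 : Type*} [RCLike 𝕜] {N : ℕ} (t : ℝ) (f : (Fin N → ℤ) → 𝕜) (n : Fin N → ℤ) : 𝕜 :=
  ∑' k : Fin N → ℤ, heatKernel t (n - k) • f k

/-- The fractional power
`(-Δ_N)^s f(n) = (1/Γ(-s)) ∫_0^∞ (W_t f(n) - f(n)) t^{-s-1} dt`, `0 < s < 1`. -/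
def fracLap {𝕜 : Type*} [RCLike 𝕜] {N : ℕ} (s : ℝ) (f : (Fin N → ℤ) → 𝕜)
    (n : Fin N → ℤ) : 𝕜 :=
  (Real.Gamma (-s))⁻¹ • ∫ t in Set.Ioi (0 : ℝ), t ^ (-s - 1) • (heat t f n - f n)

/-- Absolute convergence of everything that enters `(-Δ_N)^s f`: the series `W_t f(n)` for each
`t > 0`, and the integral in `t`. -/
def FracLapWellDefined {𝕜 : Type*} [RCLike 𝕜] {N : ℕ} (s : ℝ) (f : (Fin N → ℤ) → 𝕜) : Prop :=
  ∀ n : Fin N → ℤ,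
    (∀ t : ℝ, 0 < t → Summable fun k : Fin N → ℤ => heatKernel t (n - k) • f k) ∧
    MeasureTheory.IntegrableOn (fun t : ℝ => t ^ (-s - 1) • (heat t f n - f n))
      (Set.Ioi (0 : ℝ))

/-- The weighted space `ℓ_σ(ℤ^N) = ℓ^1(ℤ^N, w_σ)`, `w_σ(n) = (1 + |n|)^(2σ - N)`. -/
def ell (𝕜 : Type*) [RCLike 𝕜] (N : ℕ) (σ : ℝ) : Set ((Fin N → ℤ) → 𝕜) :=
  {f | Summable fun n : Fin N → ℤ => ‖f n‖ * (1 + len n) ^ (2 * σ - (N : ℝ))}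

/-- The forward difference `δ_i^+ f(n) = f(n + e_i) - f(n)`. -/
def fwd {𝕜 : Type*} [RCLike 𝕜] {N : ℕ} (i : Fin N) (f : (Fin N → ℤ) → 𝕜) :
    (Fin N → ℤ) → 𝕜 :=
  fun n => f (n + Pi.single i 1) - f n

/-- The iterated difference `(δ_1^+)^{m_1} (δ_2^+)^{m_2} ⋯ (δ_N^+)^{m_N} f`. -/
def iterFwd {𝕜 : Type*} [RCLike 𝕜] {N : ℕ} (m : Fin N → ℕ) (f : (Fin N → ℤ) → 𝕜) :
    (Fin N → ℤ) → 𝕜 :=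
  (List.finRange N).foldr (fun i g => (fwd i)^[m i] g) f

/-- The seminorm `[f]_{C^{0,α}} = sup_{n ≠ m} |f(n) - f(m)| / |n - m|^α`, in `[0, ∞]`. -/
def holderSeminormZero {𝕜 : Type*} [RCLike 𝕜] {N : ℕ} (α : ℝ) (f : (Fin N → ℤ) → 𝕜) : ℝ≥0∞ :=
  ⨆ (n : Fin N → ℤ) (m : Fin N → ℤ) (_ : n ≠ m),
    ENNReal.ofReal (‖f n - f m‖ / len (n - m) ^ α)

/-- The seminorm `[f]_{C^{k,α}} = ∑_{m_1+⋯+m_N = k} [(δ_1^+)^{m_1} ⋯ (δ_N^+)^{m_N} f]_{C^{0,α}}`,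
in `[0, ∞]`. For `k = 0` the only index is `m = 0` and it is `[f]_{C^{0,α}}`. -/
def holderSeminorm {𝕜 : Type*} [RCLike 𝕜] {N : ℕ} (k : ℕ) (α : ℝ) (f : (Fin N → ℤ) → 𝕜) :
    ℝ≥0∞ :=
  ∑ m ∈ Finset.piAntidiag (Finset.univ : Finset (Fin N)) k, holderSeminormZero α (iterFwd m f)

/-- The Hölder class `C^{k,α}(ℤ^N)`. -/
def holderClass (𝕜 : Type*) [RCLike 𝕜] (N k : ℕ) (α : ℝ) : Set ((Fin N → ℤ) → 𝕜) :=
  {f | holderSeminorm k α f < ⊤}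

end DiscreteLaplacian

end

/-! In one dimension `e^{-2t} I_n(2t)` is the law of the difference of two independent Poisson
variables of mean `t`. From this come unit mass, evenness, variance `2t`, exponential moments, and
the recurrence `mul_lineKernel`, which controls the shape of the kernel. Taking products over
coordinates gives two facts about `G_t` on `ℤ^N`: averaging a quantity of size `|k|^β`, `0 ≤ β ≤ 2`,
yields at most a multiple of `t^{β/2}` (`norm_le_of_hasSum_heatKernel_smul`), and `G_t(n)` is at
most a multiple of both `t / |n|^{N+2}` and `t^{-N/2}`.

The pointwise bounds, used for `t ≤ |n|²` and `t > |n|²`, make the integral of `t^{-s-1} G_t(n)` of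
order `|n|^{-N-2s}`, the weight of `ℓ_{-s}`. Hence absolute convergence needs no smoothness
(`fracLapWellDefined_of_mem_ell`), the fractional power commutes with differences, and the Hölder
bounds reduce to `k = 0`.

For those, put `R = |n - m|` and split the time integral at `R²` (`norm_fracLap_sub_le`). In case
(i), `(W_t - 1)f` is of order `t^{α/2}` for small times, and its increments are of order `R^α` for
large ones; both pieces give `R^{α-2s}`. In case (ii), evenness turns `(W_t - 1)f` into an average
of second differences, of order `t^{(α+1)/2}`, while its increments are at most `R` times the bound
`t^{α/2}` for `(W_t - 1)δ_i^+ f`; both pieces give `R^{α-2s+1}`. -/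

noncomputable section

namespace DiscreteLaplacian

/-! ### The one-dimensional kernel: Poisson representation, recurrence and moments -/

/-- The Poisson weights `t^l / l!`, extended by zero to negative integers. -/
def poissonWeight (t : ℝ) (l : ℤ) : ℝ :=
  if 0 ≤ l then t ^ l.toNat / (l.toNat.factorial : ℝ) else 0

/-- The one-dimensional heat kernel `e^{-2t} I_j(2t)`. -/
def lineKernel (t : ℝ) (j : ℤ) : ℝ :=
  Real.exp (-2 * t) * besselI j (2 * t)

lemma heatKernel_eq_prod {N : ℕ} (t : ℝ) (n : Fin N → ℤ) :
    heatKernel t n = ∏ i, lineKernel t (n i) := rfl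

lemma poissonWeight_natCast (t : ℝ) (j : ℕ) :
    poissonWeight t (j : ℤ) = t ^ j / (j.factorial : ℝ) := by
  simp [poissonWeight]

lemma poissonWeight_of_neg (t : ℝ) {l : ℤ} (hl : l < 0) : poissonWeight t l = 0 := by
  simp [poissonWeight, hl]

lemma poissonWeight_nonneg {t : ℝ} (ht : 0 ≤ t) (l : ℤ) : 0 ≤ poissonWeight t l := by
  unfold poissonWeight
  split_ifs <;> positivity

lemma mul_poissonWeight (t : ℝ) (l : ℤ) :
    (l : ℝ) * poissonWeight t l = t * poissonWeight t (l - 1) := by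
  rcases lt_trichotomy l 0 with h | h | h
  · rw [poissonWeight_of_neg t h, poissonWeight_of_neg t (by omega)]; simp
  · subst h; rw [poissonWeight_of_neg t (by omega : (0 : ℤ) - 1 < 0)]; simp
  · obtain ⟨j, rfl⟩ : ∃ j : ℕ, l = ((j + 1 : ℕ) : ℤ) := ⟨(l - 1).toNat, by omega⟩
    have h1 : ((j + 1 : ℕ) : ℤ) - 1 = (j : ℤ) := by push_cast; ring
    rw [h1, poissonWeight_natCast, poissonWeight_natCast, Nat.factorial_succ]
    have := Nat.factorial_ne_zero j
    push_cast
    field_simp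
    ring

lemma hasSum_int_of_nat {f : ℤ → ℝ} (hf : ∀ l < 0, f l = 0) {a : ℝ} :
    HasSum (fun j : ℕ => f j) a ↔ HasSum f a := by
  refine Function.Injective.hasSum_iff (g := fun j : ℕ => (j : ℤ)) Nat.cast_injective ?_
  intro l hl
  refine hf l (not_le.1 fun h => hl ⟨l.toNat, ?_⟩)
  simp [h]

lemma hasSum_poissonWeight (t r : ℝ) :
    HasSum (fun l : ℤ => poissonWeight t l * r ^ l) (Real.exp (t * r)) := by
  refine (hasSum_int_of_nat fun l hl => by simp [poissonWeight_of_neg t hl]).1 ?_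
  have := NormedSpace.expSeries_div_hasSum_exp (t * r)
  rw [← Real.exp_eq_exp_ℝ] at this
  refine this.congr_fun fun j => ?_
  rw [poissonWeight_natCast, mul_pow]
  simp
  ring

lemma besselI_eq_tsum {t : ℝ} (ht : 0 < t) (n : ℤ) :
    besselI n (2 * t) = ∑' l : ℤ, poissonWeight t (n + l) * poissonWeight t l := by
  have key : (fun j : ℕ => (Real.Gamma ((n : ℝ) + (j : ℝ) + 1))⁻¹ / (j.factorial : ℝ) *
      (2 * t / 2) ^ (2 * (j : ℤ) + n)) =
      fun j : ℕ => poissonWeight t (n + j) * poissonWeight t j := by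
    funext j
    have h2 : 2 * t / 2 = t := by ring
    rw [h2, poissonWeight_natCast]
    rcases lt_or_ge (n + j) 0 with h | h
    · rw [poissonWeight_of_neg t h]
      -- At the poles `Gamma` takes the value `0`, so its inverse is `0` too and matches the Poisson
      -- weight of a negative integer.
      have : Real.Gamma ((n : ℝ) + (j : ℝ) + 1) = 0 := by
        rw [Real.Gamma_eq_zero_iff]
        refine ⟨(-(n + j + 1)).toNat, ?_⟩
        have : (((-(n + j + 1)).toNat : ℤ) : ℝ) = ((-(n + j + 1) : ℤ) : ℝ) := by
          congr 1; omega
        push_cast at this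
        rw [this]; ring
      rw [this]; simp
    · obtain ⟨m, hm⟩ : ∃ m : ℕ, n + j = (m : ℤ) := ⟨(n + j).toNat, by omega⟩
      have h3 : (n : ℝ) + (j : ℝ) = (m : ℝ) := by exact_mod_cast congrArg (Int.cast (R := ℝ)) hm
      have h4 : 2 * (j : ℤ) + n = (j : ℤ) + (m : ℤ) := by omega
      rw [h3, Real.Gamma_nat_eq_factorial, hm, poissonWeight_natCast, h4, zpow_add₀ ht.ne',
        zpow_natCast, zpow_natCast]
      field_simp
  unfold besselI
  rw [key]
  refine Function.Injective.tsum_eq (g := fun j : ℕ => (j : ℤ))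
    (f := fun l : ℤ => poissonWeight t (n + l) * poissonWeight t l) Nat.cast_injective ?_
  intro l hl
  refine ⟨l.toNat, ?_⟩
  have : 0 ≤ l := not_lt.1 fun h => hl (by simp [poissonWeight_of_neg t h])
  simp [this]

/-- The shear `(a, l) ↦ (a + l, l)` of `ℤ × ℤ`. -/
def shear : ℤ × ℤ ≃ ℤ × ℤ where
  toFun p := (p.1 + p.2, p.2)
  invFun p := (p.1 - p.2, p.2)
  left_inv p := by simp
  right_inv p := by simp

/-- The product of the Poisson generating functions at `r` and `r⁻¹`, reindexed so that the first
coordinate is the difference of the two Poisson variables. -/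
lemma hasSum_poissonWeight_shear {t r : ℝ} (ht : 0 < t) (hr : 0 < r) :
    HasSum (fun p : ℤ × ℤ => poissonWeight t (p.1 + p.2) * poissonWeight t p.2 * r ^ p.1)
      (Real.exp (t * r) * Real.exp (t * r⁻¹)) := by
  have h1 := hasSum_poissonWeight t r
  have h2 := hasSum_poissonWeight t r⁻¹
  have hnn : ∀ r : ℝ, 0 < r → ∀ l : ℤ, 0 ≤ poissonWeight t l * r ^ l := fun r hr l =>
    mul_nonneg (poissonWeight_nonneg ht.le l) (zpow_pos hr l).le
  have h3 := h1.mul h2 (h1.summable.mul_of_nonneg h2.summable (hnn r hr) (hnn _ (inv_pos.2 hr)))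
  refine ((Equiv.hasSum_iff shear).2 h3).congr_fun fun p => ?_
  simp only [Function.comp, shear, Equiv.coe_fn_mk]
  rw [zpow_add₀ hr.ne', inv_zpow]
  have := (zpow_pos hr p.2).ne'
  field_simp

lemma summable_poissonWeight_shift {t : ℝ} (ht : 0 < t) (n : ℤ) :
    Summable fun l : ℤ => poissonWeight t (n + l) * poissonWeight t l := by
  simpa using (hasSum_poissonWeight_shear ht one_pos).summable.prod_factor n

lemma hasSum_lineKernel_self {t : ℝ} (ht : 0 < t) (n : ℤ) :
    HasSum (fun l : ℤ => Real.exp (-2 * t) * (poissonWeight t (n + l) * poissonWeight t l))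
      (lineKernel t n) := by
  rw [lineKernel, besselI_eq_tsum ht]
  exact (summable_poissonWeight_shift ht n).hasSum.mul_left _

lemma lineKernel_nonneg {t : ℝ} (ht : 0 < t) (n : ℤ) : 0 ≤ lineKernel t n :=
  (hasSum_lineKernel_self ht n).nonneg fun _ => mul_nonneg (Real.exp_pos _).le
    (mul_nonneg (poissonWeight_nonneg ht.le _) (poissonWeight_nonneg ht.le _))

lemma lineKernel_neg {t : ℝ} (ht : 0 < t) (n : ℤ) : lineKernel t (-n) = lineKernel t n := by
  have h := (Equiv.hasSum_iff (Equiv.addRight n)).2 (hasSum_lineKernel_self ht (-n))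
  refine h.unique ((hasSum_lineKernel_self ht n).congr_fun fun l => ?_)
  simp only [Function.comp, Equiv.coe_addRight]
  rw [show -n + (l + n) = l by ring, add_comm l n, mul_comm (poissonWeight t l)]

/-- Write `n = (n + l) - l` in the Poisson series; each term is absorbed by `mul_poissonWeight`,
which lowers one of the two indices. -/
lemma mul_lineKernel {t : ℝ} (ht : 0 < t) (n : ℤ) :
    (n : ℝ) * lineKernel t n = t * (lineKernel t (n - 1) - lineKernel t (n + 1)) := by
  have h1 := (hasSum_lineKernel_self ht n).mul_left (n : ℝ)
  have h2 := hasSum_lineKernel_self ht (n - 1)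
  have h3 := (Equiv.hasSum_iff (Equiv.subRight 1)).2 (hasSum_lineKernel_self ht (n + 1))
  refine h1.unique (((h2.sub h3).mul_left t).congr_fun fun l => ?_)
  simp only [Function.comp, Equiv.subRight_apply]
  have e1 := mul_poissonWeight t (n + l)
  have e2 := mul_poissonWeight t l
  rw [show n + 1 + (l - 1) = n + l by ring, show n - 1 + l = n + l - 1 by ring]
  push_cast at e1
  linear_combination Real.exp (-2 * t) * (poissonWeight t l * e1 - poissonWeight t (n + l) * e2)

lemma hasSum_lineKernel_zpow {t r : ℝ} (ht : 0 < t) (hr : 0 < r) :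
    HasSum (fun n : ℤ => lineKernel t n * r ^ n) (Real.exp (t * (r + r⁻¹ - 2))) := by
  have h := (hasSum_poissonWeight_shear ht hr).mul_left (Real.exp (-2 * t))
  have h' := h.prod_fiberwise (g := fun n : ℤ => lineKernel t n * r ^ n) fun n =>
    ((hasSum_lineKernel_self ht n).mul_right (r ^ n)).congr_fun fun l => by ring
  rw [← Real.exp_add, ← Real.exp_add] at h'
  rwa [show t * (r + r⁻¹ - 2) = -2 * t + (t * r + t * r⁻¹) by ring]

lemma hasSum_lineKernel {t : ℝ} (ht : 0 < t) : HasSum (lineKernel t) 1 := by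
  have := hasSum_lineKernel_zpow ht one_pos
  norm_num at this
  exact this

lemma lineKernel_le_one {t : ℝ} (ht : 0 < t) (n : ℤ) : lineKernel t n ≤ 1 :=
  le_hasSum (hasSum_lineKernel ht) n fun _ _ => lineKernel_nonneg ht _

lemma lineKernel_natAbs {t : ℝ} (ht : 0 < t) (n : ℤ) :
    lineKernel t (n.natAbs : ℤ) = lineKernel t n := by
  rcases Int.natAbs_eq n with h | h
  · rw [← h]
  · conv_rhs => rw [h, lineKernel_neg ht]

lemma summable_mul_lineKernel {t : ℝ} (ht : 0 < t) :
    Summable fun n : ℤ => (n : ℝ) * lineKernel t n := by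
  have h := (hasSum_lineKernel_zpow ht (Real.exp_pos 1)).summable
  have h' := (hasSum_lineKernel_zpow ht (inv_pos.2 (Real.exp_pos 1))).summable
  refine Summable.of_norm_bounded (h.add h') fun n => ?_
  rw [norm_mul, Real.norm_of_nonneg (lineKernel_nonneg ht n), mul_comm, ← mul_add]
  refine mul_le_mul_of_nonneg_left ?_ (lineKernel_nonneg ht n)
  rw [← Real.exp_neg, ← Real.rpow_intCast, ← Real.rpow_intCast, ← Real.exp_mul, ← Real.exp_mul,
    mul_comm 1, mul_comm (-1), Real.norm_eq_abs]
  have h1 := Real.add_one_le_exp ((n : ℝ) * 1)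
  have h2 := Real.add_one_le_exp ((n : ℝ) * (-1))
  have h3 := Real.exp_pos ((n : ℝ) * 1)
  have h4 := Real.exp_pos ((n : ℝ) * (-1))
  rw [abs_le]
  constructor <;> linarith

/-- Multiply the recurrence by `n` and shift the sums: with `S` the first moment they become `S + 1`
and `S - 1`, so `S` cancels and need not be known. -/
lemma hasSum_sq_mul_lineKernel {t : ℝ} (ht : 0 < t) :
    HasSum (fun n : ℤ => (n : ℝ) ^ 2 * lineKernel t n) (2 * t) := by
  have s0 := hasSum_lineKernel ht
  have s1 := (summable_mul_lineKernel ht).hasSum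
  have hp := (Equiv.hasSum_iff (Equiv.subRight (1 : ℤ))).2 (s1.add s0)
  have hm := (Equiv.hasSum_iff (Equiv.addRight (1 : ℤ))).2 (s1.sub s0)
  have h := (hp.sub hm).mul_left t
  have hv : ∀ S : ℝ, t * (S + 1 - (S - 1)) = 2 * t := fun S => by ring
  rw [hv] at h
  refine h.congr_fun fun n => ?_
  have := mul_lineKernel ht n
  simp only [Function.comp, Equiv.subRight_apply, Equiv.coe_addRight]
  push_cast
  linear_combination (n : ℝ) * this

/-! ### Pointwise bounds for the one-dimensional kernel -/

/-- By the recurrence at `n + 1`, `t` times the drop over two steps is `n + 1` times a kernel value.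
Monotonicity within each parity class is all that is used later. -/
lemma lineKernel_add_two_le {t : ℝ} (ht : 0 < t) (n : ℕ) :
    lineKernel t ((n : ℤ) + 2) ≤ lineKernel t n := by
  have h := mul_lineKernel ht (n + 1)
  rw [show (n : ℤ) + 1 - 1 = n by ring, show (n : ℤ) + 1 + 1 = n + 2 by ring] at h
  have h0 : (0 : ℝ) ≤ (((n : ℤ) + 1 : ℤ) : ℝ) * lineKernel t (n + 1) :=
    mul_nonneg (by positivity) (lineKernel_nonneg ht _)
  rw [h] at h0
  linarith [nonneg_of_mul_nonneg_right h0 ht]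

lemma lineKernel_add_two_mul_le {t : ℝ} (ht : 0 < t) (n i : ℕ) :
    lineKernel t ((n + 2 * i : ℕ) : ℤ) ≤ lineKernel t n := by
  induction i with
  | zero => simp
  | succ i ih =>
    refine le_trans ?_ ih
    have := lineKernel_add_two_le ht (n + 2 * i)
    rwa [show ((n + 2 * i : ℕ) : ℤ) + 2 = (n + 2 * (i + 1) : ℕ) by push_cast; ring] at this

lemma lineKernel_le_max {t : ℝ} (ht : 0 < t) (n : ℤ) :
    lineKernel t n ≤ max (lineKernel t 0) (lineKernel t 1) := by
  rw [← lineKernel_natAbs ht]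
  obtain ⟨i, hi | hi⟩ : ∃ i : ℕ, n.natAbs = 0 + 2 * i ∨ n.natAbs = 1 + 2 * i :=
    ⟨n.natAbs / 2, by omega⟩
  · rw [hi]
    exact (lineKernel_add_two_mul_le ht 0 i).trans (le_max_left _ _)
  · rw [hi]
    exact (lineKernel_add_two_mul_le ht 1 i).trans (le_max_right _ _)

lemma sum_range_comp_le {f : ℤ → ℝ} (hf : ∀ l, 0 ≤ f l) {a : ℝ} (ha : HasSum f a)
    {φ : ℕ → ℤ} (hφ : Function.Injective φ) (m : ℕ) :
    ∑ i ∈ Finset.range m, f (φ i) ≤ a := by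
  rw [← Finset.sum_image (f := f) (g := φ) fun x _ y _ h => hφ h]
  exact sum_le_hasSum _ (fun l _ => hf l) ha

/-- The `l`-th double step from `e` loses at most `2(l + 1)/t` times the maximum of the kernel, and
these losses add up to `L(L + 1)/t`. -/
lemma sub_le_lineKernel_add_two_mul {t : ℝ} (ht : 0 < t) {e : ℕ} (he : e ≤ 1) (L : ℕ) :
    lineKernel t e - max (lineKernel t 0) (lineKernel t 1) * (L * (L + 1)) / t ≤
      lineKernel t ((e + 2 * L : ℕ) : ℤ) := by
  induction L with
  | zero => simp
  | succ L ih =>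
    set p := max (lineKernel t 0) (lineKernel t 1)
    have h := mul_lineKernel ht ((e + 2 * L : ℕ) + 1)
    rw [show ((e + 2 * L : ℕ) : ℤ) + 1 - 1 = (e + 2 * L : ℕ) by ring,
      show ((e + 2 * L : ℕ) : ℤ) + 1 + 1 = (e + 2 * (L + 1) : ℕ) by push_cast; ring] at h
    have h1 : ((((e + 2 * L : ℕ) : ℤ) + 1 : ℤ) : ℝ) * lineKernel t ((e + 2 * L : ℕ) + 1) ≤
        (2 * L + 2) * p := by
      have he' : (e : ℝ) ≤ 1 := by exact_mod_cast he
      refine mul_le_mul ?_ (lineKernel_le_max ht _) (lineKernel_nonneg ht _) (by positivity)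
      push_cast
      linarith
    rw [h] at h1
    have h2 : lineKernel t ((e + 2 * L : ℕ) : ℤ) - lineKernel t ((e + 2 * (L + 1) : ℕ) : ℤ) ≤
        (2 * L + 2) * p / t := by
      rw [le_div_iff₀ ht]; linarith
    have h3 : p * (((L + 1 : ℕ) : ℝ) * ((L + 1 : ℕ) + 1)) / t =
        p * (L * (L + 1)) / t + (2 * L + 2) * p / t := by
      push_cast; ring
    linarith

/-- The maximum `p` is attained at `0` or `1`, and the kernel cannot drop below `p/4` for about
`√t/2` double steps. Total mass `1` then forces `p √t ≤ 8`. -/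
lemma lineKernel_mul_sqrt_le {t : ℝ} (ht : 0 < t) (n : ℤ) : lineKernel t n * √t ≤ 8 := by
  rcases le_total t 1 with h1 | h1
  · have := mul_le_mul (lineKernel_le_one ht n) (Real.sqrt_le_one.2 h1) (Real.sqrt_nonneg t)
      zero_le_one
    linarith
  · obtain ⟨e, he, hmax⟩ : ∃ e : ℕ, e ≤ 1 ∧
        max (lineKernel t 0) (lineKernel t 1) = lineKernel t (e : ℤ) := by
      rcases max_choice (lineKernel t 0) (lineKernel t 1) with h | h
      · exact ⟨0, by simp, by simpa using h⟩
      · exact ⟨1, by simp, by simpa using h⟩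
    have hn := lineKernel_le_max ht n
    have hlow := fun L => sub_le_lineKernel_add_two_mul ht he L
    rw [hmax] at hn hlow
    set p := lineKernel t (e : ℤ)
    have hp : 0 ≤ p := lineKernel_nonneg ht _
    have hs1 : 1 ≤ √t := Real.one_le_sqrt.2 h1
    have hst : √t * √t = t := Real.mul_self_sqrt ht.le
    set L := ⌊√t / 2⌋₊
    have hL1 : (L : ℝ) ≤ √t / 2 := Nat.floor_le (by positivity)
    have hL2 : √t / 2 < L + 1 := Nat.lt_floor_add_one _
    have hterm : ∀ l ∈ Finset.range (L + 1), p / 4 ≤ lineKernel t ((e + 2 * l : ℕ) : ℤ) := by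
      intro l hl
      refine le_trans ?_ (hlow l)
      have hl' : (l : ℝ) ≤ √t / 2 :=
        le_trans (by exact_mod_cast Nat.lt_succ_iff.1 (Finset.mem_range.1 hl)) hL1
      have h2 : (l : ℝ) * (l + 1) ≤ 3 / 4 * t := by
        have : (l : ℝ) * (l + 1) ≤ √t / 2 * (√t / 2 + 1) := by gcongr
        nlinarith
      have h3 : p * ((l : ℝ) * (l + 1)) / t ≤ 3 / 4 * p := by
        rw [div_le_iff₀ ht]
        nlinarith [mul_le_mul_of_nonneg_left h2 hp]
      linarith
    have hsum := sum_range_comp_le (lineKernel_nonneg ht) (hasSum_lineKernel ht)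
      (φ := fun l => ((e + 2 * l : ℕ) : ℤ)) (fun a b hab => by
        have : ((e + 2 * a : ℕ) : ℤ) = ((e + 2 * b : ℕ) : ℤ) := hab
        omega) (L + 1)
    have h4 := (Finset.card_nsmul_le_sum _ _ _ hterm).trans hsum
    rw [Finset.card_range, nsmul_eq_mul] at h4
    push_cast at h4
    have h5 : √t / 2 * (p / 4) ≤ 1 :=
      le_trans (mul_le_mul_of_nonneg_right hL2.le (by positivity)) h4
    have h6 := mul_le_mul_of_nonneg_right hn (Real.sqrt_nonneg t)
    linarith

lemma exp_add_exp_neg_sub_two_le {u : ℝ} (h0 : 0 ≤ u) (h1 : u ≤ 1) :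
    Real.exp u + Real.exp (-u) - 2 ≤ 2 * u ^ 2 := by
  have a := (abs_le.1 (Real.abs_exp_sub_one_sub_id_le (abs_le.2 ⟨by linarith, h1⟩))).2
  have b := (abs_le.1 (Real.abs_exp_sub_one_sub_id_le (x := -u)
    (abs_le.2 ⟨by linarith, by linarith⟩))).2
  nlinarith

/-- The exponential moment is `exp(t(e^u + e^{-u} - 2))`, whose exponent is at most `2tu² ≤ 2`. -/
lemma exists_hasSum_lineKernel_exp {t u : ℝ} (ht : 0 < t) (h0 : 0 ≤ u) (h1 : u ≤ 1)
    (htu : t * u ^ 2 ≤ 1) :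
    ∃ a, HasSum (fun n : ℤ => lineKernel t n * Real.exp (n * u)) a ∧ a ≤ Real.exp 2 := by
  have h := hasSum_lineKernel_zpow ht (Real.exp_pos u)
  refine ⟨_, h.congr_fun fun n => ?_, ?_⟩
  · rw [← Real.rpow_intCast, ← Real.exp_mul, mul_comm u]
  · rw [Real.exp_le_exp, ← Real.exp_neg]
    have := mul_le_mul_of_nonneg_left (exp_add_exp_neg_sub_two_le h0 h1) ht.le
    linarith

/-- A single term of the exponential moment would lose a factor `√t`. Instead, monotonicity gives
about `j/4` points in `[j/2, j]` with kernel value at least that at `j`; their number supplies the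
extra power of `j`. -/
lemma lineKernel_mul_pow_le_of_one_le (m : ℕ) {t : ℝ} (ht : 1 ≤ t) (j : ℕ) :
    lineKernel t j * (j : ℝ) ^ (m + 1) ≤
      4 * Real.exp 2 * (2 ^ m * (m.factorial : ℝ)) * √t ^ m := by
  have ht0 : 0 < t := by linarith
  have hs1 : 1 ≤ √t := Real.one_le_sqrt.2 ht
  have hs0 : 0 < √t := by linarith
  have hst : √t ^ 2 = t := Real.sq_sqrt ht0.le
  -- `u = 1/√t` is the largest rate allowed by `t u² ≤ 1`.
  obtain ⟨a, ha, ha2⟩ := exists_hasSum_lineKernel_exp (u := (√t)⁻¹) ht0 (by positivity)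
    (inv_le_one_of_one_le₀ hs1) (by rw [inv_pow, hst, mul_inv_cancel₀ ht0.ne'])
  set g := lineKernel t (j : ℤ)
  have hg : 0 ≤ g := lineKernel_nonneg ht0 _
  set x : ℝ := j / 2 * (√t)⁻¹
  have hterm : ∀ i ∈ Finset.range (j / 4 + 1), g * Real.exp x ≤
      lineKernel t ((j : ℤ) - 2 * i) * Real.exp ((((j : ℤ) - 2 * i : ℤ) : ℝ) * (√t)⁻¹) := by
    intro i hi
    have hi' : 4 * i ≤ j := by have := Finset.mem_range.1 hi; omega
    refine mul_le_mul ?_ ?_ (Real.exp_pos _).le (lineKernel_nonneg ht0 _)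
    · have := lineKernel_add_two_mul_le ht0 (j - 2 * i) i
      rw [Nat.sub_add_cancel (by omega)] at this
      rwa [Nat.cast_sub (by omega)] at this
    · rw [Real.exp_le_exp]
      refine mul_le_mul_of_nonneg_right ?_ (by positivity)
      have : (4 : ℝ) * i ≤ j := by exact_mod_cast hi'
      push_cast
      linarith
  have hsum := sum_range_comp_le
    (fun l => mul_nonneg (lineKernel_nonneg ht0 l) (Real.exp_pos _).le) ha
    (φ := fun i : ℕ => (j : ℤ) - 2 * i) (fun a b hab => by
      have : (j : ℤ) - 2 * a = j - 2 * b := hab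
      omega) (j / 4 + 1)
  have h4 := (Finset.card_nsmul_le_sum _ _ _ hterm).trans (hsum.trans ha2)
  rw [Finset.card_range, nsmul_eq_mul] at h4
  have h5 : (j : ℝ) / 4 ≤ ((j / 4 + 1 : ℕ) : ℝ) := by
    have : j ≤ 4 * (j / 4 + 1) := by omega
    have : (j : ℝ) ≤ 4 * ((j / 4 + 1 : ℕ) : ℝ) := by exact_mod_cast this
    linarith
  have hx : 0 ≤ x := by positivity
  have h6 : x ^ m ≤ m.factorial * Real.exp x := by
    have := Real.pow_div_factorial_le_exp x hx m
    rwa [div_le_iff₀ (by positivity), mul_comm] at this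
  have h7 : (j : ℝ) ^ m = 2 ^ m * √t ^ m * x ^ m := by
    rw [← mul_pow, ← mul_pow]; congr 1; simp only [x]; field_simp
  calc g * (j : ℝ) ^ (m + 1) = 4 * (2 ^ m * √t ^ m) * (j / 4 * (g * x ^ m)) := by
        rw [pow_succ, h7]; ring
    _ ≤ 4 * (2 ^ m * √t ^ m) * (((j / 4 + 1 : ℕ) : ℝ) * (g * (m.factorial * Real.exp x))) := by
        gcongr
    _ = 4 * (2 ^ m * √t ^ m) * m.factorial * (((j / 4 + 1 : ℕ) : ℝ) * (g * Real.exp x)) := by ring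
    _ ≤ 4 * (2 ^ m * √t ^ m) * m.factorial * Real.exp 2 := by gcongr
    _ = _ := by ring

/-- For small times the factor `t` comes from the recurrence, `j g(j) ≤ t g(j - 1)`; the exponential
moment at rate `1` absorbs the remaining powers of `j`. -/
lemma lineKernel_mul_pow_le_of_le_one (m : ℕ) {t : ℝ} (ht0 : 0 < t) (ht : t ≤ 1) (j : ℕ) :
    lineKernel t j * (j : ℝ) ^ (m + 1) ≤ Real.exp 3 * (m.factorial : ℝ) * t := by
  rcases Nat.eq_zero_or_pos j with rfl | hj
  · simp; positivity
  obtain ⟨a, ha, ha2⟩ := exists_hasSum_lineKernel_exp (u := 1) ht0 zero_le_one le_rfl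
    (by linarith)
  have h1 : lineKernel t (j - 1) * Real.exp (j - 1) ≤ Real.exp 2 := by
    have := (le_hasSum ha ((j : ℤ) - 1) fun l _ =>
      mul_nonneg (lineKernel_nonneg ht0 l) (Real.exp_pos _).le).trans ha2
    push_cast at this
    simpa using this
  have h2 : lineKernel t j * (j : ℝ) ≤ t * lineKernel t (j - 1) := by
    have := mul_lineKernel ht0 j
    push_cast at this
    have h := mul_nonneg ht0.le (lineKernel_nonneg ht0 (j + 1))
    linarith
  have h3 : (j : ℝ) ^ m ≤ m.factorial * Real.exp j := by
    have := Real.pow_div_factorial_le_exp (j : ℝ) (by positivity) m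
    rwa [div_le_iff₀ (by positivity), mul_comm] at this
  have h4 : Real.exp (j : ℝ) = Real.exp (j - 1) * Real.exp 1 := by
    rw [← Real.exp_add]; congr 1; ring
  have h5 : Real.exp 3 = Real.exp 2 * Real.exp 1 := by
    rw [← Real.exp_add]; norm_num
  have hg := lineKernel_nonneg ht0 ((j : ℤ) - 1)
  calc lineKernel t j * (j : ℝ) ^ (m + 1) = (lineKernel t j * j) * (j : ℝ) ^ m := by ring
    _ ≤ (t * lineKernel t (j - 1)) * (m.factorial * Real.exp j) := by gcongr
    _ = t * m.factorial * Real.exp 1 * (lineKernel t (j - 1) * Real.exp (j - 1)) := by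
        rw [h4]; ring
    _ ≤ t * m.factorial * Real.exp 1 * Real.exp 2 := by gcongr
    _ = _ := by rw [h5]; ring

/-! ### The kernel in dimension `N`: decay, mass and second moments -/

lemma heatKernel_nonneg {N : ℕ} {t : ℝ} (ht : 0 < t) (n : Fin N → ℤ) : 0 ≤ heatKernel t n :=
  Finset.prod_nonneg fun i _ => lineKernel_nonneg ht (n i)

lemma heatKernel_neg {N : ℕ} {t : ℝ} (ht : 0 < t) (n : Fin N → ℤ) :
    heatKernel t (-n) = heatKernel t n :=
  Finset.prod_congr rfl fun i _ => lineKernel_neg ht (n i)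

lemma heatKernel_le_one {N : ℕ} {t : ℝ} (ht : 0 < t) (n : Fin N → ℤ) : heatKernel t n ≤ 1 :=
  Finset.prod_le_one (fun i _ => lineKernel_nonneg ht (n i)) fun i _ => lineKernel_le_one ht (n i)

lemma heatKernel_mul_sqrt_pow_le {N : ℕ} {t : ℝ} (ht : 0 < t) (n : Fin N → ℤ) :
    heatKernel t n * √t ^ N ≤ 8 ^ N := by
  have := Finset.prod_le_prod (s := Finset.univ) (f := fun i => lineKernel t (n i) * √t)
    (g := fun _ => (8 : ℝ)) (fun i _ => mul_nonneg (lineKernel_nonneg ht _) (Real.sqrt_nonneg t))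
    fun i _ => lineKernel_mul_sqrt_le ht (n i)
  simpa [Finset.prod_mul_distrib, heatKernel_eq_prod] using this

lemma len_nonneg {N : ℕ} (n : Fin N → ℤ) : 0 ≤ len n :=
  Finset.sum_nonneg fun _ _ => abs_nonneg _

lemma exists_len_le {N : ℕ} (hN : 1 ≤ N) (n : Fin N → ℤ) :
    ∃ i, len n ≤ N * |(n i : ℝ)| := by
  have : Nonempty (Fin N) := ⟨⟨0, hN⟩⟩
  obtain ⟨i, -, hi⟩ := Finset.exists_max_image Finset.univ (fun i => |(n i : ℝ)|)
    Finset.univ_nonempty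
  refine ⟨i, ?_⟩
  have := Finset.sum_le_card_nsmul Finset.univ (fun i => |(n i : ℝ)|) _ hi
  simpa [len] using this

/-- Off-diagonal decay of the heat kernel, at the order matched to the spatial dimension. -/
lemma exists_heatKernel_mul_len_pow_le {N : ℕ} (hN : 1 ≤ N) :
    ∃ C : ℝ, 0 ≤ C ∧ ∀ t : ℝ, 0 < t → ∀ n : Fin N → ℤ,
      heatKernel t n * len n ^ (N + 2) ≤ C * t := by
  obtain ⟨A, hA, hA'⟩ : ∃ A : ℝ, 0 ≤ A ∧ ∀ t : ℝ, 1 ≤ t → ∀ j : ℕ,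
      lineKernel t j * (j : ℝ) ^ (N + 2) ≤ A * √t ^ (N + 1) :=
    ⟨_, by positivity, fun t ht j => lineKernel_mul_pow_le_of_one_le (N + 1) ht j⟩
  obtain ⟨B, hB, hB'⟩ : ∃ B : ℝ, 0 ≤ B ∧ ∀ t : ℝ, 0 < t → t ≤ 1 → ∀ j : ℕ,
      lineKernel t j * (j : ℝ) ^ (N + 2) ≤ B * t :=
    ⟨_, by positivity, fun t h0 ht j => lineKernel_mul_pow_le_of_le_one (N + 1) h0 ht j⟩
  refine ⟨(N : ℝ) ^ (N + 2) * (8 ^ (N - 1) * A + B), by positivity, fun t ht n => ?_⟩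
  obtain ⟨i, hi⟩ := exists_len_le hN n
  have hg := lineKernel_nonneg ht (n i)
  -- The largest coordinate `i` carries the decay; `q` is the product over the others, bounded by
  -- `1` for small times and by a multiple of `t^{-(N-1)/2}` for large ones.
  obtain ⟨q, hq0, hG, hq1, hq8⟩ : ∃ q : ℝ, 0 ≤ q ∧ heatKernel t n = lineKernel t (n i) * q ∧
      q ≤ 1 ∧ q * √t ^ (N - 1) ≤ 8 ^ (N - 1) := by
    refine ⟨∏ l ∈ Finset.univ.erase i, lineKernel t (n l),
      Finset.prod_nonneg fun l _ => lineKernel_nonneg ht _,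
      (Finset.mul_prod_erase _ (fun l => lineKernel t (n l)) (Finset.mem_univ i)).symm,
      Finset.prod_le_one (fun l _ => lineKernel_nonneg ht _) fun l _ => lineKernel_le_one ht _, ?_⟩
    have := Finset.prod_le_prod (s := Finset.univ.erase i)
      (f := fun l => lineKernel t (n l) * √t) (g := fun _ => (8 : ℝ))
      (fun l _ => mul_nonneg (lineKernel_nonneg ht _) (Real.sqrt_nonneg t))
      fun l _ => lineKernel_mul_sqrt_le ht (n l)
    simpa [Finset.prod_mul_distrib] using this
  have key : heatKernel t n * |(n i : ℝ)| ^ (N + 2) ≤ (8 ^ (N - 1) * A + B) * t := by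
    have hj : ∀ c : ℝ, lineKernel t (n i).natAbs * ((n i).natAbs : ℝ) ^ (N + 2) ≤ c →
        heatKernel t n * |(n i : ℝ)| ^ (N + 2) ≤ c * q := by
      intro c hc
      rw [lineKernel_natAbs ht, Nat.cast_natAbs, Int.cast_abs] at hc
      rw [hG, mul_right_comm]
      exact mul_le_mul_of_nonneg_right hc hq0
    rcases le_total t 1 with h1 | h1
    · refine (hj _ (hB' t ht h1 _)).trans ?_
      refine (mul_le_of_le_one_right (by positivity) hq1).trans ?_
      exact mul_le_mul_of_nonneg_right (le_add_of_nonneg_left (by positivity)) ht.le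
    · refine (hj _ (hA' t h1 _)).trans ?_
      -- The `N - 1` factors `√t` are exactly those that `q` compensates, leaving one power of `t`.
      have hs : √t ^ (N + 1) = √t ^ (N - 1) * t := by
        conv_rhs => rw [← Real.sq_sqrt ht.le, Real.sqrt_sq (Real.sqrt_nonneg t)]
        rw [← pow_add]; congr 1; omega
      rw [hs, show A * (√t ^ (N - 1) * t) * q = A * t * (q * √t ^ (N - 1)) by ring,
        show (8 ^ (N - 1) * A + B) * t = A * t * 8 ^ (N - 1) + B * t by ring]
      exact (mul_le_mul_of_nonneg_left hq8 (by positivity)).trans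
        (le_add_of_nonneg_right (by positivity))
  calc heatKernel t n * len n ^ (N + 2)
      ≤ heatKernel t n * (N * |(n i : ℝ)|) ^ (N + 2) := by
        have := heatKernel_nonneg ht n
        have := len_nonneg n
        gcongr
    _ = (N : ℝ) ^ (N + 2) * (heatKernel t n * |(n i : ℝ)| ^ (N + 2)) := by ring
    _ ≤ (N : ℝ) ^ (N + 2) * ((8 ^ (N - 1) * A + B) * t) := by gcongr
    _ = _ := by ring

lemma hasSum_mul_of_nonneg {α β : Type*} {f : α → ℝ} {g : β → ℝ} {a b : ℝ}
    (hf : ∀ x, 0 ≤ f x) (hg : ∀ y, 0 ≤ g y) (ha : HasSum f a) (hb : HasSum g b) :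
    HasSum (fun p : α × β => f p.1 * g p.2) (a * b) :=
  ha.mul hb (ha.summable.mul_of_nonneg hb.summable hf hg)

lemma hasSum_pi_prod {N : ℕ} (f : Fin N → ℤ → ℝ) (a : Fin N → ℝ) (hf : ∀ i l, 0 ≤ f i l)
    (ha : ∀ i, HasSum (f i) (a i)) :
    HasSum (fun n : Fin N → ℤ => ∏ i, f i (n i)) (∏ i, a i) := by
  induction N with
  | zero =>
    simp
  | succ N ih =>
    have h1 := ih (fun i => f i.succ) (fun i => a i.succ) (fun i => hf _) fun i => ha _
    have hnn : ∀ n : Fin N → ℤ, 0 ≤ ∏ i, f i.succ (n i) :=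
      fun n => Finset.prod_nonneg fun i _ => hf _ _
    have h2 := hasSum_mul_of_nonneg (hf 0) hnn (ha 0) h1
    rw [Fin.prod_univ_succ]
    have e := Equiv.hasSum_iff (f := fun n : Fin (N + 1) → ℤ => ∏ i, f i (n i))
      (a := a 0 * ∏ i : Fin N, a i.succ) (Fin.consEquiv fun _ : Fin (N + 1) => ℤ)
    refine e.1 (h2.congr_fun fun p => ?_)
    simp [Fin.consEquiv, Fin.prod_univ_succ]

lemma hasSum_heatKernel {N : ℕ} {t : ℝ} (ht : 0 < t) :
    HasSum (fun n : Fin N → ℤ => heatKernel t n) 1 := by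
  simpa [heatKernel_eq_prod] using hasSum_pi_prod (fun _ : Fin N => lineKernel t) (fun _ => 1)
    (fun _ => lineKernel_nonneg ht) fun _ => hasSum_lineKernel ht

lemma hasSum_sq_mul_heatKernel {N : ℕ} {t : ℝ} (ht : 0 < t) (i : Fin N) :
    HasSum (fun n : Fin N → ℤ => (n i : ℝ) ^ 2 * heatKernel t n) (2 * t) := by
  have h := hasSum_pi_prod
    (fun l : Fin N => fun x : ℤ => (if l = i then (x : ℝ) ^ 2 else 1) * lineKernel t x)
    (fun l => if l = i then 2 * t else 1)
    (fun l x => mul_nonneg (by split_ifs <;> positivity) (lineKernel_nonneg ht x))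
    (fun l => by
      split_ifs
      · exact hasSum_sq_mul_lineKernel ht
      · simpa using hasSum_lineKernel ht)
  simp only [Finset.prod_mul_distrib, Finset.prod_ite_eq', Finset.mem_univ, if_true] at h
  exact h

lemma len_sq_le {N : ℕ} (n : Fin N → ℤ) : len n ^ 2 ≤ N * ∑ i, (n i : ℝ) ^ 2 := by
  simpa [len] using sq_sum_le_card_mul_sum_sq (s := Finset.univ) (f := fun i => |(n i : ℝ)|)

lemma hasSum_sum_sq_mul_heatKernel {N : ℕ} {t : ℝ} (ht : 0 < t) :
    HasSum (fun n : Fin N → ℤ => heatKernel t n * (N * ∑ i, (n i : ℝ) ^ 2))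
      (2 * (N : ℝ) ^ 2 * t) := by
  have h := (hasSum_sum fun i (_ : i ∈ Finset.univ) =>
    hasSum_sq_mul_heatKernel (N := N) ht i).mul_left (N : ℝ)
  rw [Finset.sum_const, Finset.card_univ, Fintype.card_fin, nsmul_eq_mul,
    show (N : ℝ) * (N * (2 * t)) = 2 * (N : ℝ) ^ 2 * t by ring] at h
  refine h.congr_fun fun n => ?_
  rw [← Finset.sum_mul]; ring

lemma rpow_le_one_add_sq {x β : ℝ} (hx : 0 ≤ x) (h0 : 0 ≤ β) (h2 : β ≤ 2) :
    x ^ β ≤ 1 + x ^ 2 := by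
  rcases le_total x 1 with h | h
  · have := Real.rpow_le_one hx h h0
    nlinarith
  · have := Real.rpow_le_rpow_of_exponent_le h h2
    rw [Real.rpow_two] at this
    linarith

/-- Rescale by `√t` and use `x^β ≤ 1 + x²`: any power up to `2` is then controlled by mass and
variance alone. -/
lemma len_rpow_le {N : ℕ} {t β : ℝ} (ht : 0 < t) (h0 : 0 ≤ β) (h2 : β ≤ 2) (n : Fin N → ℤ) :
    len n ^ β ≤ t ^ (β / 2) * (1 + t⁻¹ * (N * ∑ i, (n i : ℝ) ^ 2)) := by
  have hs : 0 < √t := Real.sqrt_pos.2 ht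
  have h := rpow_le_one_add_sq (div_nonneg (len_nonneg n) hs.le) h0 h2
  rw [Real.div_rpow (len_nonneg n) hs.le, div_pow, Real.sq_sqrt ht.le, Real.sqrt_eq_rpow,
    ← Real.rpow_mul ht.le, one_div_mul_eq_div, div_le_iff₀' (by positivity)] at h
  refine h.trans ?_
  have := mul_le_mul_of_nonneg_left (len_sq_le n) (inv_pos.2 ht).le
  rw [div_eq_inv_mul (len n ^ 2)]
  gcongr

/-- A kernel average of quantities of order `|k|^β`, `0 ≤ β ≤ 2`, is of order `t^{β/2}`. -/
lemma norm_le_of_hasSum_heatKernel_smul {E : Type*} [NormedAddCommGroup E] [NormedSpace ℝ E]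
    {N : ℕ} {t β H : ℝ} (ht : 0 < t) (h0 : 0 ≤ β) (h2 : β ≤ 2) (hH : 0 ≤ H)
    {v : (Fin N → ℤ) → E} (hv : ∀ k, ‖v k‖ ≤ H * len k ^ β) {D : E}
    (hD : HasSum (fun k => heatKernel t k • v k) D) :
    ‖D‖ ≤ H * (1 + 2 * (N : ℝ) ^ 2) * t ^ (β / 2) := by
  have h := ((hasSum_heatKernel (N := N) ht).add
    ((hasSum_sum_sq_mul_heatKernel (N := N) ht).mul_left t⁻¹)).mul_left (H * t ^ (β / 2))
  have := hD.norm_le_of_bounded h fun k => ?_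
  · refine this.trans (le_of_eq ?_)
    field_simp
  · rw [norm_smul, Real.norm_of_nonneg (heatKernel_nonneg ht k)]
    calc heatKernel t k * ‖v k‖ ≤ heatKernel t k * (H *
          (t ^ (β / 2) * (1 + t⁻¹ * (N * ∑ i, (k i : ℝ) ^ 2)))) :=
          mul_le_mul_of_nonneg_left ((hv k).trans
            (mul_le_mul_of_nonneg_left (len_rpow_le ht h0 h2 k) hH)) (heatKernel_nonneg ht k)
      _ = _ := by ring

/-! ### The lattice length and finite differences -/

lemma len_zero {N : ℕ} : len (0 : Fin N → ℤ) = 0 := by simp [len]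

lemma len_neg {N : ℕ} (n : Fin N → ℤ) : len (-n) = len n := by simp [len]

lemma len_add_le {N : ℕ} (n m : Fin N → ℤ) : len (n + m) ≤ len n + len m := by
  rw [len, len, len, ← Finset.sum_add_distrib]
  refine Finset.sum_le_sum fun i _ => ?_
  simpa using abs_add_le (n i : ℝ) (m i)

lemma one_le_len {N : ℕ} {n : Fin N → ℤ} (hn : n ≠ 0) : 1 ≤ len n := by
  obtain ⟨i, hi⟩ := Function.ne_iff.1 hn
  have h1 : (1 : ℝ) ≤ |(n i : ℝ)| := by exact_mod_cast Int.one_le_abs hi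
  exact h1.trans (Finset.single_le_sum (f := fun i => |(n i : ℝ)|)
    (fun _ _ => abs_nonneg _) (Finset.mem_univ i))

section Differences

variable {𝕜 : Type*} [RCLike 𝕜] {N : ℕ}

lemma norm_sub_le_of_fwd_single {φ : (Fin N → ℤ) → 𝕜} {B : ℝ} {i : Fin N}
    (h : ∀ p, ‖fwd i φ p‖ ≤ B) (j : ℕ) (n : Fin N → ℤ) :
    ‖φ (n + Pi.single i (j : ℤ)) - φ n‖ ≤ B * j := by
  induction j with
  | zero => simp
  | succ j ih =>
    have e : n + Pi.single i (((j + 1 : ℕ)) : ℤ) = n + Pi.single i (j : ℤ) + Pi.single i 1 := by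
      rw [add_assoc, ← Pi.single_add]; push_cast; rfl
    have h1 := h (n + Pi.single i (j : ℤ))
    rw [fwd, ← e] at h1
    have := norm_sub_le_norm_sub_add_norm_sub (φ (n + Pi.single i ((j + 1 : ℕ) : ℤ)))
      (φ (n + Pi.single i (j : ℤ))) (φ n)
    push_cast at *
    linarith

/-- A function on `ℤ^N` with differences bounded by `B` is `B`-Lipschitz for `|·|`. -/
lemma norm_sub_le_of_fwd {φ : (Fin N → ℤ) → 𝕜} {B : ℝ} (h : ∀ i p, ‖fwd i φ p‖ ≤ B)
    (n m : Fin N → ℤ) : ‖φ n - φ m‖ ≤ B * len (n - m) := by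
  have h1 : ∀ (i : Fin N) (z : ℤ) (p : Fin N → ℤ),
      ‖φ (p + Pi.single i z) - φ p‖ ≤ B * |(z : ℝ)| := by
    intro i z p
    have habs : |(z : ℝ)| = (z.natAbs : ℝ) := by rw [Nat.cast_natAbs, Int.cast_abs]
    rw [habs]
    rcases Int.natAbs_eq z with hz | hz
    · conv_lhs => rw [hz]
      exact norm_sub_le_of_fwd_single (h i) _ p
    · have := norm_sub_le_of_fwd_single (h i) z.natAbs (p + Pi.single i z)
      rwa [add_assoc, ← Pi.single_add, show z + (z.natAbs : ℤ) = 0 by omega, Pi.single_zero,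
        add_zero, norm_sub_rev] at this
  have h2 : ∀ (S : Finset (Fin N)) (d : Fin N → ℤ),
      ‖φ (m + ∑ i ∈ S, Pi.single i (d i)) - φ m‖ ≤ B * ∑ i ∈ S, |(d i : ℝ)| := by
    intro S d
    induction S using Finset.induction_on with
    | empty => simp
    | insert i S hi ih =>
      rw [Finset.sum_insert hi, Finset.sum_insert hi, add_comm, add_comm _ (∑ i ∈ S, _),
        add_comm _ m, ← add_assoc, mul_add]
      have := norm_sub_le_norm_sub_add_norm_sub
        (φ (m + ∑ i ∈ S, Pi.single i (d i) + Pi.single i (d i)))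
        (φ (m + ∑ i ∈ S, Pi.single i (d i))) (φ m)
      linarith [h1 i (d i) (m + ∑ i ∈ S, Pi.single i (d i))]
  have := h2 Finset.univ (n - m)
  rwa [Finset.univ_sum_single, add_sub_cancel] at this

lemma fwd_comm (i j : Fin N) (f : (Fin N → ℤ) → 𝕜) : fwd i (fwd j f) = fwd j (fwd i f) := by
  funext n
  simp only [fwd]
  rw [add_right_comm]
  ring

lemma foldr_fwd_congr (l : List (Fin N)) {m m' : Fin N → ℕ} (h : ∀ i ∈ l, m i = m' i)
    (f : (Fin N → ℤ) → 𝕜) :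
    l.foldr (fun i g => (fwd i)^[m i] g) f = l.foldr (fun i g => (fwd i)^[m' i] g) f := by
  induction l with
  | nil => rfl
  | cons j l ih =>
    simp only [List.foldr_cons]
    rw [ih fun i hi => h i (List.mem_cons_of_mem _ hi), h j List.mem_cons_self]

/-- The extra difference enters at the slot of `i`, which occurs only once, and moves to the front
because differences commute. -/
lemma foldr_fwd_add_single (l : List (Fin N)) (hl : l.Nodup) (m : Fin N → ℕ) {i : Fin N}
    (hi : i ∈ l) (f : (Fin N → ℤ) → 𝕜) :
    l.foldr (fun j g => (fwd j)^[(m + Pi.single i 1 : Fin N → ℕ) j] g) f =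
      fwd i (l.foldr (fun j g => (fwd j)^[m j] g) f) := by
  induction l with
  | nil => simp at hi
  | cons j l ih =>
    rw [List.nodup_cons] at hl
    simp only [List.foldr_cons]
    rcases eq_or_ne i j with rfl | hij
    · rw [foldr_fwd_congr l (m := m + Pi.single i 1) (m' := m)]
      · simp [Function.iterate_succ_apply']
      · intro a ha
        have : a ≠ i := fun h => hl.1 (h ▸ ha)
        simp [this]
    · rw [ih hl.2 ((List.mem_cons.1 hi).resolve_left hij)]
      simp only [Pi.add_apply, Pi.single_eq_of_ne hij.symm, add_zero]
      exact (Function.Commute.iterate_left (fun g => fwd_comm j i g) (m j)) _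

lemma iterFwd_add_single (m : Fin N → ℕ) (i : Fin N) (f : (Fin N → ℤ) → 𝕜) :
    iterFwd (m + Pi.single i 1) f = fwd i (iterFwd m f) :=
  foldr_fwd_add_single _ (List.nodup_finRange N) m (List.mem_finRange i) f

/-- A property stable under differences holds for all iterated differences, and operators
commuting with differences on it commute with iterated differences. -/
lemma iterFwd_induction {P : ((Fin N → ℤ) → 𝕜) → Prop} (hP : ∀ i f, P f → P (fwd i f))
    {T : ((Fin N → ℤ) → 𝕜) → (Fin N → ℤ) → 𝕜} (hT : ∀ i f, P f → T (fwd i f) = fwd i (T f))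
    (m : Fin N → ℕ) {f : (Fin N → ℤ) → 𝕜} (hf : P f) :
    P (iterFwd m f) ∧ T (iterFwd m f) = iterFwd m (T f) := by
  have hiter : ∀ (i : Fin N) (j : ℕ) g, P g →
      P ((fwd i)^[j] g) ∧ T ((fwd i)^[j] g) = (fwd i)^[j] (T g) := by
    intro i j g hg
    induction j with
    | zero => exact ⟨hg, rfl⟩
    | succ j ih =>
      rw [Function.iterate_succ_apply', Function.iterate_succ_apply']
      exact ⟨hP _ _ ih.1, by rw [hT _ _ ih.1, ih.2]⟩
  unfold iterFwd
  induction List.finRange N with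
  | nil => exact ⟨hf, rfl⟩
  | cons i l ih =>
    simp only [List.foldr_cons]
    obtain ⟨h1, h2⟩ := hiter i (m i) _ ih.1
    exact ⟨h1, by rw [h2, ih.2]⟩

end Differences

/-! ### Integrals in time -/

open MeasureTheory Set in
/-- Integrating `t^{-s-1} D(t)` when `D` is of order `t^a` for small and `t^b` for large times,
`b < s < a`. -/
lemma integrableOn_and_integral_norm_le {E : Type*} [NormedAddCommGroup E] [NormedSpace ℝ E]
    {D : ℝ → E} {s a b A B R : ℝ} (hR : 0 < R) (hb : b < s) (ha : s < a)
    (hm : AEStronglyMeasurable (fun t : ℝ => t ^ (-s - 1) • D t) (volume.restrict (Ioi 0)))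
    (hA : ∀ t, 0 < t → t ≤ R ^ 2 → ‖D t‖ ≤ A * t ^ a)
    (hB : ∀ t, R ^ 2 < t → ‖D t‖ ≤ B * t ^ b) :
    IntegrableOn (fun t : ℝ => t ^ (-s - 1) • D t) (Ioi 0) ∧
      ∫ t in Ioi (0 : ℝ), ‖t ^ (-s - 1) • D t‖ ≤
        A * R ^ (2 * (a - s)) / (a - s) + B * R ^ (2 * (b - s)) / (s - b) := by
  have hR2 : 0 < R ^ 2 := by positivity
  have hpow : ∀ c : ℝ, (R ^ 2) ^ c = R ^ (2 * c) := fun c => by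
    rw [← Real.rpow_two, ← Real.rpow_mul hR.le]
  have hnorm : ∀ t : ℝ, 0 < t → ∀ c K : ℝ, ‖D t‖ ≤ K * t ^ c →
      ‖t ^ (-s - 1) • D t‖ ≤ K * t ^ (c - s - 1) := by
    intro t ht c K h
    rw [norm_smul, Real.norm_of_nonneg (by positivity),
      show c - s - 1 = (-s - 1) + c by ring, Real.rpow_add ht, mul_left_comm]
    gcongr
  have hi1 : IntervalIntegrable (fun t : ℝ => A * t ^ (a - s - 1)) volume 0 (R ^ 2) :=
    (intervalIntegral.intervalIntegrable_rpow' (by linarith)).const_mul A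
  have hi1' : IntegrableOn (fun t : ℝ => A * t ^ (a - s - 1)) (Ioc 0 (R ^ 2)) :=
    (intervalIntegrable_iff_integrableOn_Ioc_of_le hR2.le).1 hi1
  have hi2 : IntegrableOn (fun t : ℝ => B * t ^ (b - s - 1)) (Ioi (R ^ 2)) :=
    (integrableOn_Ioi_rpow_of_lt (by linarith) hR2).const_mul B
  have hle1 : ∀ t ∈ Ioc 0 (R ^ 2), ‖t ^ (-s - 1) • D t‖ ≤ A * t ^ (a - s - 1) :=
    fun t ht => hnorm t ht.1 a A (hA t ht.1 ht.2)
  have hle2 : ∀ t ∈ Ioi (R ^ 2), ‖t ^ (-s - 1) • D t‖ ≤ B * t ^ (b - s - 1) :=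
    fun t ht => hnorm t (hR2.trans ht) b B (hB t ht)
  have hD1 : IntegrableOn (fun t : ℝ => t ^ (-s - 1) • D t) (Ioc 0 (R ^ 2)) :=
    Integrable.mono' hi1' (hm.mono_measure (Measure.restrict_mono Ioc_subset_Ioi_self le_rfl))
      ((ae_restrict_iff' measurableSet_Ioc).2 (Filter.Eventually.of_forall hle1))
  have hD2 : IntegrableOn (fun t : ℝ => t ^ (-s - 1) • D t) (Ioi (R ^ 2)) :=
    Integrable.mono' hi2
      (hm.mono_measure (Measure.restrict_mono (Ioi_subset_Ioi hR2.le) le_rfl))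
      ((ae_restrict_iff' measurableSet_Ioi).2 (Filter.Eventually.of_forall hle2))
  have hU : Ioc 0 (R ^ 2) ∪ Ioi (R ^ 2) = Ioi 0 := Ioc_union_Ioi_eq_Ioi hR2.le
  refine ⟨hU ▸ hD1.union hD2, ?_⟩
  rw [← hU, setIntegral_union (Ioc_disjoint_Ioi le_rfl) measurableSet_Ioi hD1.norm hD2.norm]
  refine add_le_add ?_ ?_
  · refine (setIntegral_mono_on hD1.norm hi1' measurableSet_Ioc hle1).trans (le_of_eq ?_)
    rw [← intervalIntegral.integral_of_le hR2.le, intervalIntegral.integral_const_mul,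
      integral_rpow (Or.inl (by linarith)), show a - s - 1 + 1 = a - s by ring,
      Real.zero_rpow (by linarith), hpow, sub_zero, mul_div_assoc]
  · refine (setIntegral_mono_on hD2.norm hi2 measurableSet_Ioi hle2).trans (le_of_eq ?_)
    rw [integral_const_mul, integral_Ioi_rpow_of_lt (by linarith) hR2,
      show b - s - 1 + 1 = b - s by ring, hpow, mul_div_assoc, ← neg_sub s b, neg_div_neg_eq]

open MeasureTheory in
lemma aestronglyMeasurable_of_hasSum {α ι E : Type*} [Countable ι] [MeasurableSpace α]
    {μ : Measure α} [NormedAddCommGroup E] {f : ι → α → E} {F : α → E}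
    (hf : ∀ i, AEStronglyMeasurable (f i) μ) (h : ∀ᵐ x ∂μ, HasSum (fun i => f i x) (F x)) :
    AEStronglyMeasurable F μ :=
  aestronglyMeasurable_of_tendsto_ae (Filter.atTop : Filter (Finset ι))
    (fun S => Finset.aestronglyMeasurable_fun_sum S fun i _ => hf i) h

open MeasureTheory in
lemma integrable_of_hasSum {α ι E : Type*} [Countable ι] [MeasurableSpace α]
    {μ : Measure α} [NormedAddCommGroup E] {f : ι → α → E} {F : α → E}
    (hf : ∀ i, Integrable (f i) μ) (hs : Summable fun i => ∫ x, ‖f i x‖ ∂μ)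
    (h : ∀ᵐ x ∂μ, HasSum (fun i => f i x) (F x)) :
    Integrable F μ := by
  refine ⟨aestronglyMeasurable_of_hasSum (fun i => (hf i).1) h, ?_⟩
  have h1 : ∫⁻ x, ‖F x‖ₑ ∂μ ≤ ∑' i, ∫⁻ x, ‖f i x‖ₑ ∂μ := by
    rw [← lintegral_tsum fun i => (hf i).1.enorm]
    refine lintegral_mono_ae (h.mono fun x hx => ?_)
    rw [← hx.tsum_eq]
    exact enorm_tsum_le_tsum_enorm
  refine lt_of_le_of_lt h1 ?_
  have h2 : ∀ i, ∫⁻ x, ‖f i x‖ₑ ∂μ = ENNReal.ofReal (∫ x, ‖f i x‖ ∂μ) := fun i =>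
    (ofReal_integral_norm_eq_lintegral_enorm (hf i)).symm
  simp only [h2]
  rw [← ENNReal.ofReal_tsum_of_nonneg (fun i => integral_nonneg fun x => norm_nonneg _) hs]
  exact ENNReal.ofReal_lt_top

lemma measurable_poissonWeight (l : ℤ) : Measurable fun t => poissonWeight t l := by
  unfold poissonWeight
  split_ifs <;> fun_prop

open MeasureTheory in
lemma aestronglyMeasurable_lineKernel (j : ℤ) :
    AEStronglyMeasurable (fun t => lineKernel t j) (volume.restrict (Set.Ioi 0)) := by
  refine aestronglyMeasurable_of_hasSum
    (f := fun (l : ℤ) t => Real.exp (-2 * t) * (poissonWeight t (j + l) * poissonWeight t l))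
    (fun l => ?_) ((ae_restrict_iff' measurableSet_Ioi).2
      (Filter.Eventually.of_forall fun t ht => hasSum_lineKernel_self ht j))
  have h1 := measurable_poissonWeight (j + l)
  have h2 := measurable_poissonWeight l
  exact Measurable.aestronglyMeasurable (by fun_prop)

open MeasureTheory in
lemma aestronglyMeasurable_heatKernel {N : ℕ} (n : Fin N → ℤ) :
    AEStronglyMeasurable (fun t => heatKernel t n) (volume.restrict (Set.Ioi 0)) :=
  Finset.aestronglyMeasurable_fun_prod _ fun i _ => aestronglyMeasurable_lineKernel (n i)

open MeasureTheory in
lemma aestronglyMeasurable_rpow_smul {E : Type*} [NormedAddCommGroup E] [NormedSpace ℝ E]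
    {D : ℝ → E} (r : ℝ) (hD : AEStronglyMeasurable D (volume.restrict (Set.Ioi 0))) :
    AEStronglyMeasurable (fun t : ℝ => t ^ r • D t) (volume.restrict (Set.Ioi 0)) :=
  (by fun_prop : Measurable fun t : ℝ => t ^ r).aestronglyMeasurable.smul hD

lemma heatKernel_le_rpow {N : ℕ} {t : ℝ} (ht : 0 < t) (n : Fin N → ℤ) :
    heatKernel t n ≤ 8 ^ N * t ^ (-(N / 2) : ℝ) := by
  have h := heatKernel_mul_sqrt_pow_le ht n
  have e : √t ^ N = t ^ ((N : ℝ) / 2) := by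
    rw [Real.sqrt_eq_rpow, ← Real.rpow_natCast, ← Real.rpow_mul ht.le, one_div_mul_eq_div]
  rw [e] at h
  rwa [Real.rpow_neg ht.le, ← div_eq_mul_inv, le_div_iff₀ (by positivity)]

open MeasureTheory in
/-- The kernel of the fractional power decays like `|n|^{-N-2s}`. -/
lemma exists_integral_heatKernel_le {N : ℕ} (hN : 1 ≤ N) {s : ℝ} (hs0 : 0 < s) (hs1 : s < 1) :
    ∃ C : ℝ, 0 ≤ C ∧ ∀ n : Fin N → ℤ, n ≠ 0 →
      IntegrableOn (fun t : ℝ => t ^ (-s - 1) • heatKernel t n) (Set.Ioi 0) ∧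
      ∫ t in Set.Ioi (0 : ℝ), ‖t ^ (-s - 1) • heatKernel t n‖ ≤
        C * (1 + len n) ^ (2 * (-s) - (N : ℝ)) := by
  obtain ⟨K, hK, hK'⟩ := exists_heatKernel_mul_len_pow_le hN
  have hs1' : 0 < 1 - s := by linarith
  refine ⟨(K / (1 - s) + 8 ^ N / (s + N / 2)) * 2 ^ (2 * s + N), by positivity, fun n hn => ?_⟩
  have hl1 := one_le_len hn
  have hl : 0 < len n := by linarith
  have hG : ∀ t : ℝ, 0 < t → ‖heatKernel t n‖ = heatKernel t n := fun t ht =>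
    Real.norm_of_nonneg (heatKernel_nonneg ht n)
  -- Splitting at `t = |n|²` balances the off-diagonal bound (`a = 1`) against the on-diagonal one
  -- (`b = -N/2`): both sides give `|n|^{-N-2s}`.
  obtain ⟨h1, h2⟩ := integrableOn_and_integral_norm_le (D := fun t => heatKernel t n) (s := s)
    (a := 1) (b := -(N / 2)) (A := K / len n ^ (N + 2)) (B := 8 ^ N) (R := len n) hl
    (by have : (0 : ℝ) ≤ N := Nat.cast_nonneg N
        linarith) hs1
    (aestronglyMeasurable_rpow_smul _ (aestronglyMeasurable_heatKernel n))
    (fun t ht _ => by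
      rw [hG t ht, Real.rpow_one, div_mul_eq_mul_div, le_div_iff₀ (by positivity)]
      exact hK' t ht n)
    (fun t ht => by
      have ht0 : 0 < t := lt_trans (by positivity) ht
      rw [hG t ht0]
      exact heatKernel_le_rpow ht0 n)
  refine ⟨h1, h2.trans ?_⟩
  have e1 : len n ^ (2 * (1 - s)) = len n ^ (N + 2) * len n ^ (2 * (-s) - (N : ℝ)) := by
    rw [← Real.rpow_natCast, ← Real.rpow_add hl]; congr 1; push_cast; ring
  have e2 : 2 * (-((N : ℝ) / 2) - s) = 2 * (-s) - (N : ℝ) := by ring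
  have e3 : s - -((N : ℝ) / 2) = s + N / 2 := by ring
  have e4 : len n ^ (2 * (-s) - (N : ℝ)) ≤
      2 ^ (2 * s + N) * (1 + len n) ^ (2 * (-s) - (N : ℝ)) := by
    have := Real.rpow_le_rpow_of_nonpos (z := 2 * (-s) - (N : ℝ))
      (by positivity : 0 < (1 + len n) / 2)
      (by linarith : (1 + len n) / 2 ≤ len n) (by have : (0 : ℝ) ≤ N := Nat.cast_nonneg N
                                                  linarith)
    refine this.trans (le_of_eq ?_)
    rw [Real.div_rpow (by positivity) (by norm_num), div_eq_mul_inv, ← Real.rpow_neg (by norm_num),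
      mul_comm]
    congr 2; ring
  rw [e1, e2, e3]
  calc K / len n ^ (N + 2) * (len n ^ (N + 2) * len n ^ (2 * (-s) - (N : ℝ))) / (1 - s) +
        8 ^ N * len n ^ (2 * (-s) - (N : ℝ)) / (s + N / 2)
      = (K / (1 - s) + 8 ^ N / (s + N / 2)) * len n ^ (2 * (-s) - (N : ℝ)) := by field_simp
    _ ≤ (K / (1 - s) + 8 ^ N / (s + N / 2)) *
        (2 ^ (2 * s + N) * (1 + len n) ^ (2 * (-s) - (N : ℝ))) := by gcongr
    _ = _ := by ring

/-- At fixed time the decay of order `N + 2` beats the weight of order `N + 2s`, since `s < 1`. -/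
lemma exists_heatKernel_le_weight {N : ℕ} (hN : 1 ≤ N) {s t : ℝ} (hs1 : s < 1) (ht : 0 < t) :
    ∃ C : ℝ, 0 ≤ C ∧ ∀ n : Fin N → ℤ,
      heatKernel t n ≤ C * (1 + len n) ^ (2 * (-s) - (N : ℝ)) := by
  obtain ⟨K, hK, hK'⟩ := exists_heatKernel_mul_len_pow_le hN
  refine ⟨2 ^ (N + 2) * (1 + K * t), by positivity, fun n => ?_⟩
  have hl := len_nonneg n
  have hG := heatKernel_nonneg ht n
  have h1 : heatKernel t n * (1 + len n) ^ (N + 2) ≤ 2 ^ (N + 2) * (1 + K * t) := by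
    have h2 : (1 + len n) ^ (N + 2) ≤ 2 ^ (N + 2) * (1 + len n ^ (N + 2)) := by
      rcases le_total (len n) 1 with h | h
      · calc (1 + len n) ^ (N + 2) ≤ 2 ^ (N + 2) := by
              refine pow_le_pow_left₀ (by positivity) (by linarith) _
          _ ≤ _ := le_mul_of_one_le_right (by positivity) (by
              have := pow_nonneg hl (N + 2); linarith)
      · calc (1 + len n) ^ (N + 2) ≤ (2 * len n) ^ (N + 2) := by
              refine pow_le_pow_left₀ (by positivity) (by linarith) _
          _ = 2 ^ (N + 2) * len n ^ (N + 2) := mul_pow _ _ _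
          _ ≤ _ := by gcongr; linarith
    calc heatKernel t n * (1 + len n) ^ (N + 2)
        ≤ heatKernel t n * (2 ^ (N + 2) * (1 + len n ^ (N + 2))) := by gcongr
      _ = 2 ^ (N + 2) * (heatKernel t n + heatKernel t n * len n ^ (N + 2)) := by ring
      _ ≤ _ := by
          have := heatKernel_le_one ht n
          have := hK' t ht n
          gcongr
  have h3 : (1 + len n) ^ (-((N + 2 : ℕ) : ℝ)) ≤ (1 + len n) ^ (2 * (-s) - (N : ℝ)) :=
    Real.rpow_le_rpow_of_exponent_le (by linarith) (by push_cast; linarith)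
  calc heatKernel t n = heatKernel t n * (1 + len n) ^ (N + 2) *
        (1 + len n) ^ (-((N + 2 : ℕ) : ℝ)) := by
        rw [Real.rpow_neg (by positivity), Real.rpow_natCast]
        field_simp
    _ ≤ _ := by gcongr

/-! ### The semigroup and the fractional power on the weighted space -/

variable {𝕜 : Type*} [RCLike 𝕜] {N : ℕ}

/-- This comes from `1 + |k + v| ≤ (1 + |k|)(1 + |v|)`; it makes the weighted space invariant under
translations. -/
lemma one_add_len_rpow_le {e : ℝ} (he : e ≤ 0) (k v : Fin N → ℤ) :
    (1 + len k) ^ e ≤ (1 + len v) ^ (-e) * (1 + len (k + v)) ^ e := by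
  have hk := len_nonneg k
  have hv := len_nonneg v
  have hkv := len_nonneg (k + v)
  have h1 : 1 + len (k + v) ≤ (1 + len v) * (1 + len k) := by
    nlinarith [len_add_le k v, mul_nonneg hk hv]
  have h2 := Real.rpow_le_rpow_of_nonpos (by positivity) h1 he
  rw [Real.mul_rpow (by positivity) (by positivity)] at h2
  rw [Real.rpow_neg (by positivity), ← div_eq_inv_mul, le_div_iff₀' (by positivity)]
  exact h2

lemma summable_shift_of_mem_ell {s : ℝ} (hs : 0 < s) {f : (Fin N → ℤ) → 𝕜}
    (hf : f ∈ ell 𝕜 N (-s)) (v : Fin N → ℤ) :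
    Summable fun k => ‖f (k + v)‖ * (1 + len k) ^ (2 * (-s) - (N : ℝ)) := by
  have he : 2 * (-s) - (N : ℝ) ≤ 0 := by
    have : (0 : ℝ) ≤ N := Nat.cast_nonneg N
    linarith
  have hf' := ((Equiv.addRight v).summable_iff.2 (show Summable _ from hf)).mul_left
    ((1 + len v) ^ (-(2 * (-s) - (N : ℝ))))
  refine Summable.of_nonneg_of_le (fun k => ?_) (fun k => ?_) hf'
  · have := len_nonneg k
    positivity
  · have := mul_le_mul_of_nonneg_left (one_add_len_rpow_le he k v) (norm_nonneg (f (k + v)))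
    refine this.trans (le_of_eq ?_)
    simp only [Function.comp, Equiv.coe_addRight]
    ring

lemma summable_reflect_of_mem_ell {s : ℝ} (hs : 0 < s) {f : (Fin N → ℤ) → 𝕜}
    (hf : f ∈ ell 𝕜 N (-s)) (n : Fin N → ℤ) :
    Summable fun k => ‖f (n - k)‖ * (1 + len k) ^ (2 * (-s) - (N : ℝ)) := by
  refine ((Equiv.neg _).summable_iff.2 (summable_shift_of_mem_ell hs hf n)).congr fun k => ?_
  simp only [Function.comp, Equiv.neg_apply, len_neg]
  rw [neg_add_eq_sub]

lemma fwd_mem_ell {s : ℝ} (hs : 0 < s) (i : Fin N) {f : (Fin N → ℤ) → 𝕜}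
    (hf : f ∈ ell 𝕜 N (-s)) : fwd i f ∈ ell 𝕜 N (-s) := by
  refine Summable.of_nonneg_of_le (fun k => ?_) (fun k => ?_)
    ((summable_shift_of_mem_ell hs hf (Pi.single i 1)).add hf)
  · have := len_nonneg k
    positivity
  · rw [← add_mul]
    have := len_nonneg k
    exact mul_le_mul_of_nonneg_right (norm_sub_le _ _) (by positivity)

lemma summable_heat (hN : 1 ≤ N) {s t : ℝ} (hs0 : 0 < s) (hs1 : s < 1) (ht : 0 < t)
    {f : (Fin N → ℤ) → 𝕜} (hf : f ∈ ell 𝕜 N (-s)) (n : Fin N → ℤ) :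
    Summable fun k => heatKernel t k • f (n - k) := by
  obtain ⟨C, hC, hC'⟩ := exists_heatKernel_le_weight hN hs1 ht
  refine Summable.of_norm_bounded ((summable_reflect_of_mem_ell hs0 hf n).mul_left C) fun k => ?_
  rw [norm_smul, Real.norm_of_nonneg (heatKernel_nonneg ht k), mul_left_comm, mul_comm]
  exact mul_le_mul_of_nonneg_left (hC' k) (norm_nonneg _)

lemma hasSum_heat (hN : 1 ≤ N) {s t : ℝ} (hs0 : 0 < s) (hs1 : s < 1) (ht : 0 < t)
    {f : (Fin N → ℤ) → 𝕜} (hf : f ∈ ell 𝕜 N (-s)) (n : Fin N → ℤ) :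
    HasSum (fun k => heatKernel t k • f (n - k)) (heat t f n) := by
  have h := (summable_heat hN hs0 hs1 ht hf n).hasSum
  have e : heat t f n = ∑' k, heatKernel t k • f (n - k) := by
    rw [heat, ← (Equiv.subLeft n).tsum_eq]
    simp
  rwa [e]

lemma hasSum_heat_sub (hN : 1 ≤ N) {s t : ℝ} (hs0 : 0 < s) (hs1 : s < 1) (ht : 0 < t)
    {f : (Fin N → ℤ) → 𝕜} (hf : f ∈ ell 𝕜 N (-s)) (n : Fin N → ℤ) :
    HasSum (fun k => heatKernel t k • (f (n - k) - f n)) (heat t f n - f n) := by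
  have h := (hasSum_heat hN hs0 hs1 ht hf n).sub ((hasSum_heatKernel (N := N) ht).smul_const (f n))
  rw [one_smul] at h
  exact h.congr_fun fun k => by rw [smul_sub]

/-- Averaging over `k` and `-k`, by evenness of the kernel, produces second differences; they supply
the additional order of smallness in case (ii). -/
lemma hasSum_heat_sub_symm (hN : 1 ≤ N) {s t : ℝ} (hs0 : 0 < s) (hs1 : s < 1) (ht : 0 < t)
    {f : (Fin N → ℤ) → 𝕜} (hf : f ∈ ell 𝕜 N (-s)) (n : Fin N → ℤ) :
    HasSum (fun k => heatKernel t k • ((f (n + k) - f n) - (f n - f (n - k))))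
      ((2 : ℝ) • (heat t f n - f n)) := by
  have h := hasSum_heat_sub hN hs0 hs1 ht hf n
  rw [two_smul]
  refine (((Equiv.neg (Fin N → ℤ)).hasSum_iff.2 h).add h).congr_fun fun k => ?_
  simp only [Function.comp, Equiv.neg_apply, heatKernel_neg ht, sub_neg_eq_add]
  rw [← smul_add]
  congr 1
  ring

lemma abs_heatKernel_zero_sub_one_le {t : ℝ} (ht : 0 < t) :
    ‖heatKernel t (0 : Fin N → ℤ) - 1‖ ≤ (1 + 2 * (N : ℝ) ^ 2) * t ^ (1 : ℝ) := by
  -- The difference is the average of `1_{k = 0} - 1`, which is at most `|k|²` in size because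
  -- nonzero lattice points have length at least `1`.
  have h : HasSum (fun k : Fin N → ℤ => heatKernel t k • ((if k = 0 then 1 else 0) - 1 : ℝ))
      (heatKernel t (0 : Fin N → ℤ) - 1) := by
    refine ((hasSum_ite_eq (0 : Fin N → ℤ) (heatKernel t (0 : Fin N → ℤ))).sub
      (hasSum_heatKernel ht)).congr_fun fun k => ?_
    rcases eq_or_ne k 0 with rfl | hk <;> simp_all
  have := norm_le_of_hasSum_heatKernel_smul (β := 2) (H := 1) ht (by norm_num) le_rfl
    zero_le_one (fun k => ?_) h
  · simpa using this
  · rcases eq_or_ne k 0 with rfl | hk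
    · simp [len_zero]
    · have := one_le_len hk
      simp only [hk, if_false, zero_sub, norm_neg, norm_one, one_mul]
      exact Real.one_le_rpow this (by norm_num)

-- Only the term `k = 0` needs the cancellation with `f(n)`, through `G_t(0) - 1 = O(t)`. All others
-- are integrable against `t^{-s-1}` on their own, with norms summable by the very definition of the
-- weighted space.
open MeasureTheory in
theorem fracLapWellDefined_of_mem_ell (hN : 1 ≤ N) {s : ℝ} (hs0 : 0 < s) (hs1 : s < 1)
    {f : (Fin N → ℤ) → 𝕜} (hf : f ∈ ell 𝕜 N (-s)) : FracLapWellDefined s f := by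
  intro n
  refine ⟨fun t ht => ?_, ?_⟩
  · refine ((Equiv.subLeft n).summable_iff.2 (summable_heat hN hs0 hs1 ht hf n)).congr fun k => ?_
    simp
  obtain ⟨C, hC, hC'⟩ := exists_integral_heatKernel_le hN hs0 hs1
  have hdiag : IntegrableOn (fun t : ℝ => t ^ (-s - 1) • (heatKernel t (0 : Fin N → ℤ) - 1))
      (Set.Ioi 0) := by
    refine (integrableOn_and_integral_norm_le
      (D := fun t => heatKernel t (0 : Fin N → ℤ) - 1) (a := 1) (b := 0) (A := 1 + 2 * (N : ℝ) ^ 2)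
      (B := 1) (R := 1) one_pos hs0 hs1 (aestronglyMeasurable_rpow_smul _
        ((aestronglyMeasurable_heatKernel _).sub aestronglyMeasurable_const))
      (fun t ht _ => abs_heatKernel_zero_sub_one_le ht) fun t ht => ?_).1
    have ht0 : 0 < t := lt_trans (by norm_num) ht
    rw [Real.rpow_zero, one_mul, Real.norm_eq_abs, abs_le]
    constructor <;> linarith [heatKernel_nonneg ht0 (0 : Fin N → ℤ),
      heatKernel_le_one ht0 (0 : Fin N → ℤ)]
  have hoff : IntegrableOn (fun t : ℝ => t ^ (-s - 1) •
      (heat t f n - heatKernel t (0 : Fin N → ℤ) • f n)) (Set.Ioi 0) := by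
    have hint : ∀ k : Fin N → ℤ, k ≠ 0 → ∀ z : 𝕜,
        IntegrableOn (fun t : ℝ => (t ^ (-s - 1) • heatKernel t k) • z) (Set.Ioi 0) :=
      fun k hk z => (hC' k hk).1.smul_const z
    refine integrable_of_hasSum (f := fun (k : Fin N → ℤ) t =>
      if k = 0 then 0 else (t ^ (-s - 1) • heatKernel t k) • f (n - k)) (fun k => ?_) ?_ ?_
    · rcases eq_or_ne k 0 with rfl | hk
      · simp
      · simpa [hk, IntegrableOn] using hint k hk (f (n - k))
    · refine Summable.of_nonneg_of_le (fun k => integral_nonneg fun t => norm_nonneg _)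
        (fun k => ?_) ((summable_reflect_of_mem_ell hs0 hf n).mul_left C)
      rcases eq_or_ne k 0 with rfl | hk
      · have := len_nonneg (0 : Fin N → ℤ)
        simp only [if_true, norm_zero, integral_zero]
        positivity
      · simp only [hk, if_false, norm_smul _ (f (n - k))]
        rw [integral_mul_const, mul_comm (‖f (n - k)‖), ← mul_assoc]
        exact mul_le_mul_of_nonneg_right (hC' k hk).2 (norm_nonneg _)
    · refine (ae_restrict_iff' measurableSet_Ioi).2 (Filter.Eventually.of_forall fun t ht => ?_)
      refine (((hasSum_heat hN hs0 hs1 ht hf n).sub (hasSum_ite_eq (0 : Fin N → ℤ)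
        (heatKernel t (0 : Fin N → ℤ) • f n))).const_smul (t ^ (-s - 1))).congr_fun fun k => ?_
      rcases eq_or_ne k 0 with rfl | hk
      · simp
      · simp [hk, smul_smul]
  refine (hoff.add (hdiag.smul_const (f n))).congr (Filter.Eventually.of_forall fun t => ?_)
  simp only [Pi.add_apply, smul_eq_mul, mul_smul, ← smul_add, sub_smul, one_smul]
  congr 1
  ring

lemma heat_fwd (hN : 1 ≤ N) {s t : ℝ} (hs0 : 0 < s) (hs1 : s < 1) (ht : 0 < t) (i : Fin N)
    {f : (Fin N → ℤ) → 𝕜} (hf : f ∈ ell 𝕜 N (-s)) : heat t (fwd i f) = fwd i (heat t f) := by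
  funext n
  refine (hasSum_heat hN hs0 hs1 ht (fwd_mem_ell hs0 i hf) n).unique ?_
  refine ((hasSum_heat hN hs0 hs1 ht hf (n + Pi.single i 1)).sub
    (hasSum_heat hN hs0 hs1 ht hf n)).congr_fun fun k => ?_
  rw [← smul_sub, fwd, sub_add_eq_add_sub]

lemma fracLap_fwd (hN : 1 ≤ N) {s : ℝ} (hs0 : 0 < s) (hs1 : s < 1) (i : Fin N)
    {f : (Fin N → ℤ) → 𝕜} (hf : f ∈ ell 𝕜 N (-s)) : fracLap s (fwd i f) = fwd i (fracLap s f) := by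
  funext n
  have hw := fracLapWellDefined_of_mem_ell hN hs0 hs1 hf
  simp only [fwd, fracLap]
  rw [← smul_sub, ← MeasureTheory.integral_sub (hw _).2 (hw _).2]
  congr 1
  refine MeasureTheory.setIntegral_congr_fun measurableSet_Ioi fun t ht => ?_
  have := congrFun (heat_fwd hN hs0 hs1 ht i hf) n
  simp only [fwd] at this
  change t ^ (-s - 1) • (heat t (fwd i f) n - fwd i f n) = _
  rw [show heat t (fwd i f) n = _ from this, fwd, ← smul_sub]
  congr 1
  ring

lemma iterFwd_mem_ell_and_fracLap (hN : 1 ≤ N) {s : ℝ} (hs0 : 0 < s) (hs1 : s < 1)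
    (m : Fin N → ℕ) {f : (Fin N → ℤ) → 𝕜} (hf : f ∈ ell 𝕜 N (-s)) :
    iterFwd m f ∈ ell 𝕜 N (-s) ∧ fracLap s (iterFwd m f) = iterFwd m (fracLap s f) :=
  iterFwd_induction (P := fun f => f ∈ ell 𝕜 N (-s)) (T := fracLap s)
    (fun i _ => fwd_mem_ell hs0 i) (fun i _ => fracLap_fwd hN hs0 hs1 i) m hf

/-! ### Hölder estimates for the fractional power -/

/-- Hölder bounds for `(-Δ)^s f` from bounds on `(W_t - 1)f` at small times and on its
increments at large times. -/
lemma norm_fracLap_sub_le (hN : 1 ≤ N) {s : ℝ} (hs0 : 0 < s) (hs1 : s < 1)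
    {f : (Fin N → ℤ) → 𝕜} (hf : f ∈ ell 𝕜 N (-s)) {a b A B R : ℝ} (hR : 0 < R) (hb : b < s)
    (ha : s < a) {n m : Fin N → ℤ}
    (hA : ∀ p t, 0 < t → ‖heat t f p - f p‖ ≤ A * t ^ a)
    (hB : ∀ t, 0 < t → ‖(heat t f n - f n) - (heat t f m - f m)‖ ≤ B * t ^ b) :
    ‖fracLap s f n - fracLap s f m‖ ≤ |(Real.Gamma (-s))⁻¹| *
      (2 * A * R ^ (2 * (a - s)) / (a - s) + B * R ^ (2 * (b - s)) / (s - b)) := by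
  have hw := fracLapWellDefined_of_mem_ell hN hs0 hs1 hf
  have hint := (hw n).2.sub (hw m).2
  simp only [fracLap]
  rw [← smul_sub, ← MeasureTheory.integral_sub (hw _).2 (hw _).2, norm_smul, Real.norm_eq_abs]
  refine mul_le_mul_of_nonneg_left ?_ (abs_nonneg _)
  refine (MeasureTheory.norm_integral_le_integral_norm _).trans ?_
  simp only [← smul_sub]
  refine (integrableOn_and_integral_norm_le hR hb ha ?_ (fun t ht _ => ?_) fun t ht => ?_).2
  · refine hint.1.congr (Filter.Eventually.of_forall fun t => ?_)
    simp only [Pi.sub_apply, smul_sub]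
  · have := norm_sub_le (heat t f n - f n) (heat t f m - f m)
    linarith [hA n t ht, hA m t ht]
  · exact hB t (lt_trans (by positivity) ht)

/-- The case `2s < α` for functions of finite `C^{0,α}` seminorm. -/
lemma norm_fracLap_sub_le_of_holder (hN : 1 ≤ N) {s α H : ℝ} (hs0 : 0 < s) (hs1 : s < 1)
    (hα1 : α ≤ 1) (hsα : 2 * s < α) (hH : 0 ≤ H) {f : (Fin N → ℤ) → 𝕜}
    (hf : f ∈ ell 𝕜 N (-s)) (hfH : ∀ n m, ‖f n - f m‖ ≤ H * len (n - m) ^ α) {n m : Fin N → ℤ}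
    (hnm : n ≠ m) :
    ‖fracLap s f n - fracLap s f m‖ ≤ |(Real.Gamma (-s))⁻¹| *
      (2 * (1 + 2 * (N : ℝ) ^ 2) / (α / 2 - s) + 2 / s) * H * len (n - m) ^ (α - 2 * s) := by
  have hR : 0 < len (n - m) := one_pos.trans_le (one_le_len (sub_ne_zero.2 hnm))
  -- `a = α/2` is the average of `|k|^α`. For large times `W_t f` and `f` each have increment at
  -- most `H |n - m|^α`, whence `b = 0` and the `2` in `B`.
  have h := norm_fracLap_sub_le hN hs0 hs1 hf (a := α / 2) (b := 0)
    (A := H * (1 + 2 * (N : ℝ) ^ 2)) (B := 2 * H * len (n - m) ^ α) hR hs0 (by linarith)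
    (n := n) (m := m) (fun p t ht => ?_) (fun t ht => ?_)
  · refine h.trans (le_of_eq ?_)
    have e : len (n - m) ^ (α - 2 * s) = len (n - m) ^ α * len (n - m) ^ (2 * (0 - s)) := by
      rw [← Real.rpow_add hR]; congr 1; ring
    rw [show 2 * (α / 2 - s) = α - 2 * s by ring, sub_zero, e]
    ring
  · refine norm_le_of_hasSum_heatKernel_smul ht (by linarith) (by linarith) hH (fun k => ?_)
      (hasSum_heat_sub hN hs0 hs1 ht hf p)
    simpa [len_neg] using hfH (p - k) p
  · have h1 : ‖heat t f n - heat t f m‖ ≤ H * len (n - m) ^ α := by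
      have := ((hasSum_heat hN hs0 hs1 ht hf n).sub
        (hasSum_heat hN hs0 hs1 ht hf m)).norm_le_of_bounded
        ((hasSum_heatKernel (N := N) ht).mul_right (H * len (n - m) ^ α)) fun k => ?_
      · simpa using this
      · rw [← smul_sub, norm_smul, Real.norm_of_nonneg (heatKernel_nonneg ht k)]
        have := hfH (n - k) (m - k)
        rw [sub_sub_sub_cancel_right] at this
        exact mul_le_mul_of_nonneg_left this (heatKernel_nonneg ht k)
    rw [sub_sub_sub_comm, Real.rpow_zero, mul_one]
    refine (norm_sub_le _ _).trans ?_
    linarith [hfH n m]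

/-- The case `α < 2s < α + 1` for functions of finite `C^{1,α}` seminorm. -/
lemma norm_fracLap_sub_le_of_fwd_holder (hN : 1 ≤ N) {s α H : ℝ} (hs0 : 0 < s) (hs1 : s < 1)
    (hα0 : 0 < α) (hα1 : α ≤ 1) (hsα : α < 2 * s) (hsα' : 2 * s < α + 1) (hH : 0 ≤ H)
    {f : (Fin N → ℤ) → 𝕜} (hf : f ∈ ell 𝕜 N (-s))
    (hfH : ∀ i n m, ‖fwd i f n - fwd i f m‖ ≤ H * len (n - m) ^ α) {n m : Fin N → ℤ}
    (hnm : n ≠ m) :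
    ‖fracLap s f n - fracLap s f m‖ ≤ |(Real.Gamma (-s))⁻¹| *
      (1 + 2 * (N : ℝ) ^ 2) * (1 / ((α + 1) / 2 - s) + 1 / (s - α / 2)) * H *
        len (n - m) ^ (α - 2 * s + 1) := by
  have hR : 0 < len (n - m) := one_pos.trans_le (one_le_len (sub_ne_zero.2 hnm))
  -- `a` comes from second differences of order `|k|^{α+1}`, and the `/ 2` in `A` from the
  -- symmetrised identity. `b = α/2` comes from `(W_t - 1)δ_i^+ f`, with a factor `|n - m|` for the
  -- length of a lattice path.
  have h := norm_fracLap_sub_le hN hs0 hs1 hf (a := (α + 1) / 2) (b := α / 2)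
    (A := H * (1 + 2 * (N : ℝ) ^ 2) / 2) (B := H * (1 + 2 * (N : ℝ) ^ 2) * len (n - m)) hR
    (by linarith) (by linarith) (n := n) (m := m) (fun p t ht => ?_) (fun t ht => ?_)
  · refine h.trans (le_of_eq ?_)
    have e : len (n - m) ^ (α - 2 * s + 1) = len (n - m) * len (n - m) ^ (2 * (α / 2 - s)) := by
      rw [← Real.rpow_one_add' hR.le (by linarith)]; congr 1; ring
    rw [show 2 * ((α + 1) / 2 - s) = α - 2 * s + 1 by ring, e]
    ring
  · have h2 := norm_le_of_hasSum_heatKernel_smul ht (β := α + 1) (by linarith) (by linarith) hH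
      (fun k => ?_) (hasSum_heat_sub_symm hN hs0 hs1 ht hf p)
    · rw [norm_smul, Real.norm_two] at h2
      linarith
    · have hφ := norm_sub_le_of_fwd (φ := fun q => f q - f (q - k)) (B := H * len k ^ α)
        (fun i q => ?_) (p + k) p
      · simp only [add_sub_cancel_right, add_sub_cancel_left] at hφ
        rwa [Real.rpow_add_one' (len_nonneg k) (by linarith), ← mul_assoc]
      · have := hfH i q (q - k)
        rw [sub_sub_cancel] at this
        refine le_trans (le_of_eq ?_) this
        simp only [fwd]
        rw [sub_add_eq_add_sub, sub_sub_sub_comm]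
  · rw [mul_right_comm]
    refine norm_sub_le_of_fwd (φ := fun q => heat t f q - f q) (fun i q => ?_) n m
    have e : fwd i (fun q => heat t f q - f q) q = heat t (fwd i f) q - fwd i f q := by
      rw [heat_fwd hN hs0 hs1 ht i hf]
      simp only [fwd]
      rw [sub_sub_sub_comm]
    rw [e]
    refine norm_le_of_hasSum_heatKernel_smul ht (by linarith) (by linarith) hH (fun k => ?_)
      (hasSum_heat_sub hN hs0 hs1 ht (fwd_mem_ell hs0 i hf) q)
    simpa [len_neg] using hfH i (q - k) q

/-! ### From pointwise estimates to seminorms, and conclusion -/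

lemma norm_sub_le_of_holderSeminormZero {α : ℝ} (hα : 0 < α) {f : (Fin N → ℤ) → 𝕜} {H : ℝ}
    (hH : 0 ≤ H) (hf : holderSeminormZero α f ≤ ENNReal.ofReal H) (n m : Fin N → ℤ) :
    ‖f n - f m‖ ≤ H * len (n - m) ^ α := by
  rcases eq_or_ne n m with rfl | hnm
  · simp [len_zero, Real.zero_rpow hα.ne']
  · have hR : 0 < len (n - m) := one_pos.trans_le (one_le_len (sub_ne_zero.2 hnm))
    have h := (le_iSup₂_of_le n m (le_iSup (fun _ : n ≠ m =>
      ENNReal.ofReal (‖f n - f m‖ / len (n - m) ^ α)) hnm)).trans hf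
    rw [ENNReal.ofReal_le_ofReal_iff hH] at h
    rwa [← div_le_iff₀ (by positivity)]

lemma holderSeminormZero_le {α : ℝ} {f : (Fin N → ℤ) → 𝕜} {H : ℝ}
    (hf : ∀ n m, n ≠ m → ‖f n - f m‖ ≤ H * len (n - m) ^ α) :
    holderSeminormZero α f ≤ ENNReal.ofReal H := by
  refine iSup_le fun n => iSup_le fun m => iSup_le fun hnm => ENNReal.ofReal_le_ofReal ?_
  have hR : 0 < len (n - m) := one_pos.trans_le (one_le_len (sub_ne_zero.2 hnm))
  rw [div_le_iff₀ (by positivity)]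
  exact hf n m hnm

lemma holderSeminorm_le_mul {k k' : ℕ} {β α : ℝ} {c : ℝ≥0} {f g : (Fin N → ℤ) → 𝕜}
    (h : ∀ m ∈ Finset.piAntidiag (Finset.univ : Finset (Fin N)) k,
      holderSeminormZero β (iterFwd m g) ≤ c * holderSeminorm k' α f) :
    holderSeminorm k β g ≤
      ((Finset.piAntidiag (Finset.univ : Finset (Fin N)) k).card * c : ℝ≥0) *
        holderSeminorm k' α f := by
  refine (Finset.sum_le_card_nsmul _ _ _ h).trans (le_of_eq ?_)
  rw [nsmul_eq_mul]
  push_cast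
  ring

lemma holderSeminormZero_iterFwd_le {k : ℕ} {α : ℝ} {f : (Fin N → ℤ) → 𝕜} {m : Fin N → ℕ}
    (hm : m ∈ Finset.piAntidiag (Finset.univ : Finset (Fin N)) k) :
    holderSeminormZero α (iterFwd m f) ≤ holderSeminorm k α f :=
  Finset.single_le_sum (f := fun m => holderSeminormZero α (iterFwd m f))
    (fun _ _ => zero_le) hm

lemma add_single_mem_piAntidiag {k : ℕ} {m : Fin N → ℕ} (i : Fin N)
    (hm : m ∈ Finset.piAntidiag (Finset.univ : Finset (Fin N)) k) :
    m + Pi.single i 1 ∈ Finset.piAntidiag (Finset.univ : Finset (Fin N)) (k + 1) := by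
  rw [Finset.mem_piAntidiag] at hm ⊢
  refine ⟨?_, fun _ _ => Finset.mem_univ _⟩
  simp [Finset.sum_add_distrib, hm.1]

end DiscreteLaplacian

end

theorem mainTheorem10 {𝕜 : Type*} [RCLike 𝕜] (N k : ℕ) (hN : 1 ≤ N) (α s : ℝ)
    (hα0 : 0 < α) (hα1 : α ≤ 1) (hs0 : 0 < s) (hs1 : s < 1) :
    (∀ f ∈ DiscreteLaplacian.ell 𝕜 N (-s), DiscreteLaplacian.FracLapWellDefined s f) ∧
    (2 * s < α → ∃ C : NNReal, ∀ f ∈ DiscreteLaplacian.ell 𝕜 N (-s),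
      f ∈ DiscreteLaplacian.holderClass 𝕜 N k α →
        DiscreteLaplacian.fracLap s f ∈ DiscreteLaplacian.holderClass 𝕜 N k (α - 2 * s) ∧
        DiscreteLaplacian.holderSeminorm k (α - 2 * s) (DiscreteLaplacian.fracLap s f) ≤
          (C : ENNReal) * DiscreteLaplacian.holderSeminorm k α f) ∧
    (α < 2 * s → 2 * s < α + 1 → ∃ C : NNReal, ∀ f ∈ DiscreteLaplacian.ell 𝕜 N (-s),
      f ∈ DiscreteLaplacian.holderClass 𝕜 N (k + 1) α →
        DiscreteLaplacian.fracLap s f ∈ DiscreteLaplacian.holderClass 𝕜 N k (α - 2 * s + 1) ∧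
        DiscreteLaplacian.holderSeminorm k (α - 2 * s + 1) (DiscreteLaplacian.fracLap s f) ≤
          (C : ENNReal) * DiscreteLaplacian.holderSeminorm (k + 1) α f) := by
  open DiscreteLaplacian in
  refine ⟨fun f hf => fracLapWellDefined_of_mem_ell hN hs0 hs1 hf, fun hsα => ?_,
    fun hsα hsα' => ?_⟩
  · set c : ℝ := |(Real.Gamma (-s))⁻¹| *
      (2 * (1 + 2 * (N : ℝ) ^ 2) / (α / 2 - s) + 2 / s)
    have hc : 0 ≤ c := by
      have : 0 < α / 2 - s := by linarith
      positivity
    -- One copy of the order-zero constant for each multi-index of order `k`.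
    refine ⟨(Finset.piAntidiag (Finset.univ : Finset (Fin N)) k).card * c.toNNReal,
      fun f hf hfα => ?_⟩
    -- Finiteness lets the whole seminorm, as a real number, serve as the Hölder constant of every
    -- `iterFwd m f`.
    have hfin : holderSeminorm k α f ≠ ⊤ := ne_of_lt hfα
    have key := holderSeminorm_le_mul (k := k) (k' := k) (β := α - 2 * s) (α := α)
      (c := c.toNNReal) (f := f) (g := fracLap s f) fun m hm => ?_
    · exact ⟨key.trans_lt (ENNReal.mul_lt_top ENNReal.coe_lt_top hfα), key⟩
    · obtain ⟨h1, h2⟩ := iterFwd_mem_ell_and_fracLap hN hs0 hs1 m hf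
      have h3 := holderSeminormZero_iterFwd_le (α := α) (f := f) hm
      rw [← ENNReal.ofReal_toReal hfin] at h3
      rw [← h2, ← ENNReal.ofReal_toReal hfin, ← ENNReal.ofReal, ← ENNReal.ofReal_mul hc]
      exact holderSeminormZero_le fun n n' hn =>
        norm_fracLap_sub_le_of_holder hN hs0 hs1 hα1 hsα ENNReal.toReal_nonneg h1
          (norm_sub_le_of_holderSeminormZero hα0 ENNReal.toReal_nonneg h3) hn
  · set c : ℝ := |(Real.Gamma (-s))⁻¹| *
      (1 + 2 * (N : ℝ) ^ 2) * (1 / ((α + 1) / 2 - s) + 1 / (s - α / 2))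
    have hc : 0 ≤ c := by
      have : 0 < (α + 1) / 2 - s := by linarith
      have : 0 < s - α / 2 := by linarith
      positivity
    refine ⟨(Finset.piAntidiag (Finset.univ : Finset (Fin N)) k).card * c.toNNReal,
      fun f hf hfα => ?_⟩
    have hfin : holderSeminorm (k + 1) α f ≠ ⊤ := ne_of_lt hfα
    have key := holderSeminorm_le_mul (k := k) (k' := k + 1) (β := α - 2 * s + 1) (α := α)
      (c := c.toNNReal) (f := f) (g := fracLap s f) fun m hm => ?_
    · exact ⟨key.trans_lt (ENNReal.mul_lt_top ENNReal.coe_lt_top hfα), key⟩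
    · obtain ⟨h1, h2⟩ := iterFwd_mem_ell_and_fracLap hN hs0 hs1 m hf
      -- Each first difference of `iterFwd m f` is an iterated difference of order `k + 1`, so the
      -- seminorm of `f` bounds it.
      have h3 := fun i => holderSeminormZero_iterFwd_le (α := α) (f := f)
        (add_single_mem_piAntidiag i hm)
      simp only [iterFwd_add_single] at h3
      rw [← ENNReal.ofReal_toReal hfin] at h3
      rw [← h2, ← ENNReal.ofReal_toReal hfin, ← ENNReal.ofReal, ← ENNReal.ofReal_mul hc]
      exact holderSeminormZero_le fun n n' hn =>
        norm_fracLap_sub_le_of_fwd_holder hN hs0 hs1 hα0 hα1 hsα hsα' ENNReal.toReal_nonneg h1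
          (fun i => norm_sub_le_of_holderSeminormZero hα0 ENNReal.toReal_nonneg (h3 i)) hn
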